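/- \textbf{Setting.} For $\alpha\in[0,1)$ let $T_\alpha:[0,1]\to[0,1]$ be the map $T_\alpha(x)=x(1+2^\alpha x^\alpha)$ for $x\in[0,\frac12)$ and $T_\alpha(x)=2x-1$ for $x\in[\frac12,1]$ (with $T_0(x)=2x$ on $[0,\frac12)$). Let $m$ be Lebesgue measure on $[0,1]$. Let $\mathcal L_\alpha$ be the transfer operator of $T_\alpha$ with respect to $m$, $$\mathcal L_\alpha f(x)=\frac{f(y_\alpha)}{1+(1+\alpha)2^\alpha y_\alpha^\alpha}+\frac{f(\frac x2+\frac12)}2 ,$$ where $y_\alpha=y_\alpha(x)\in[0,\frac12]$ solves $y_\alpha(1+2^\alpha y_\alpha^\alpha)=x$. Let $\hat\mu_\alpha$ be the SRB measure of $T_\alpha$, i.e. its invariant probability measure equivalent to $m$, and let $\hat h_\alpha$ be its density. For $\beta_*\in(0,1)$ let $\mathcal C_*=\mathcal C_*(\beta_*)$ be the cone of all $f\in C((0,1])\cap L^1(m)$ such that $f\ge0$, $f$ is decreasing, $x^{\beta_*+1}f$ is increasing, and $f(x)\le 2^{\beta_*}(\beta_*+2)\,x^{-\beta_*}\int f\,dm$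 on $(0,1]$. Let $\beta_*\in(0,1)$, $\theta\in(0,1]$ and $C_\gamma>0$. Let $\alpha_{n,k}\in[0,\beta_*]$ ($0\le k\le n$, $n\ge1$) be a triangular array and $\gamma:[0,1]\to[0,\beta_*]$ a curve such that, for some $0=\tau_1<\tau_2<\dots<\tau_{m+1}=1$, $$|\gamma_t-\gamma_s|\le C_\gamma|t-s|^\theta\quad\text{whenever } \tau_\ell<s,t<\tau_{\ell+1}\text{ for some }\ell,\qquad \sup_{t\in[0,1]}|\alpha_{n,\lfloor nt\rfloor}-\gamma_t|\le C_\gamma n^{-\theta}\quad\text{for all }n\ge1 .$$ Write $T_{n,k}=T_{\alpha_{n,k}}$, $\mathcal L_{n,k}=\mathcal L_{\alpha_{n,k}}$ and $f_{n,k}=f\circ T_{n,k}\circ\dots\circ T_{n,1}$ (with $f_{n,0}=f$). \textbf{Lemma.} There exist constants $c_0,c_1>0$ and $p_0,p_1\in(0,1)$, where $p_0,p_1,c_1$ depend only on $\beta_*$ and $\theta$, and $c_0$ depends only on $\beta_*$, $\theta$ and $C_\gamma$, such that the following holds for every probability measure $\mu$ with density $h\in\mathcal C_*$ and every $n\ge1$.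 (0) For $0\le k\le n$ the pushforward of $\mu$ under $T_{n,k}\circ\dots\circ T_{n,1}$ has density $h_{n,k}=\mathcal L_{n,k}\cdots\mathcal L_{n,1}h$. (1) $\|h_{n,k}-\hat h_{\alpha_{n,k}}\|_{L^1(m)}\le c_0n^{-p_0}$ whenever $k$ is an integer with $n(\tau_\ell+c_1n^{p_1-1})<k<n\tau_{\ell+1}$ for some $\ell$. (2) For every $f\in L^\infty(m)$ (in particular every bounded measurable $f:[0,1]\to\mathbb R$), $|\mu(f_{n,\lfloor nt\rfloor})-\hat\mu_{\gamma_t}(f)|\le c_0\|f\|_\infty n^{-p_0}$ whenever $\tau_\ell+c_1n^{p_1-1}<t<\tau_{\ell+1}$ for some $\ell$, where $\|f\|_\infty$ is the essential supremum norm. -/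

import Mathlib

open MeasureTheory Set

namespace Intermittent

/-- Lebesgue measure on `[0,1]`, viewed as a measure on `ℝ`. -/
noncomputable def leb : Measure ℝ := volume.restrict (Icc (0 : ℝ) 1)

/-- The Pomeau--Manneville map `T_α` with parameter `α` (only its values on `[0,1]` matter). -/
noncomputable def pmMap (α : ℝ) (x : ℝ) : ℝ :=
  if x < 1 / 2 then x * (1 + 2 ^ α * x ^ α) else 2 * x - 1

/-- The formula of the left branch of `T_α`; it maps `[0,1/2]` bijectively onto `[0,1]`. -/
noncomputable def leftBranch (α : ℝ) (y : ℝ) : ℝ := y * (1 + 2 ^ α * y ^ α)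

/-- The derivative of the left branch of `T_α`. -/
noncomputable def leftBranchDeriv (α : ℝ) (y : ℝ) : ℝ := 1 + (1 + α) * 2 ^ α * y ^ α

/-- For `x ∈ [0,1]`, the preimage `y_α(x) ∈ [0,1/2]` of `x` under the left branch
(with the continuous convention `y_α(1) = 1/2` at the endpoint). -/
noncomputable def leftPreimage (α : ℝ) : ℝ → ℝ :=
  Function.invFunOn (leftBranch α) (Icc (0 : ℝ) (1 / 2))

/-- The transfer operator of `T_α` with respect to Lebesgue measure. -/
noncomputable def transfer (α : ℝ) (f : ℝ → ℝ) (x : ℝ) : ℝ :=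
  f (leftPreimage α x) / leftBranchDeriv α (leftPreimage α x) + f (x / 2 + 1 / 2) / 2

/-- The convex cone `C_*(β)` of functions on `(0,1]`. -/
structure InCone (β : ℝ) (f : ℝ → ℝ) : Prop where
  continuousOn : ContinuousOn f (Ioc 0 1)
  integrable : Integrable f leb
  nonneg : ∀ x ∈ Ioc (0 : ℝ) 1, 0 ≤ f x
  decreasing : AntitoneOn f (Ioc 0 1)
  increasing : MonotoneOn (fun x : ℝ => x ^ (β + 1) * f x) (Ioc 0 1)
  le_bound : ∀ x ∈ Ioc (0 : ℝ) 1, f x ≤ 2 ^ β * (β + 2) * x ^ (-β) * ∫ y, f y ∂leb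

/-- `μ` is an SRB measure of `T_α`: an invariant probability measure equivalent to Lebesgue
measure on `[0,1]`. For `0 ≤ α < 1` there is exactly one such measure. -/
structure IsSRBMeasure (α : ℝ) (μ : Measure ℝ) : Prop where
  isProbabilityMeasure : IsProbabilityMeasure μ
  invariant : MeasurePreserving (pmMap α) μ μ
  absolutelyContinuous : μ ≪ leb
  leb_absolutelyContinuous : leb ≪ μ

open Classical in
/-- The SRB measure of `T_α`. -/
noncomputable def srbMeasure (α : ℝ) : Measure ℝ :=
  if h : ∃ μ : Measure ℝ, IsSRBMeasure α μ then h.choose else 0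

/-- The density of the SRB measure of `T_α`. -/
noncomputable def srbDensity (α : ℝ) (x : ℝ) : ℝ := ((srbMeasure α).rnDeriv leb x).toReal

/-- The composition `T_{a k} ∘ ⋯ ∘ T_{a 1}` (the identity for `k = 0`). -/
noncomputable def evolve (a : ℕ → ℝ) : ℕ → ℝ → ℝ
  | 0 => id
  | k + 1 => pmMap (a (k + 1)) ∘ evolve a k

/-- The function `L_{a k} ⋯ L_{a 1} h` (equal to `h` for `k = 0`). -/
noncomputable def pushDensity (a : ℕ → ℝ) (h : ℝ → ℝ) : ℕ → ℝ → ℝ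
  | 0 => h
  | k + 1 => transfer (a (k + 1)) (pushDensity a h k)

/-- The data of an intermittent quasistatic dynamical system with parameters in `[0,β]`:
a triangular array `α n k`, `0 ≤ k ≤ n`, `1 ≤ n`, and a limit curve `γ` on `[0,1]`, which is
Hölder continuous with exponent `θ` on the intervals of the partition `τ` of `[0,1]`; the array
approximates the curve at rate `n ^ (-θ)`. `C` is the constant in both bounds. -/
structure IsIntermittentQDS (β θ C : ℝ) (α : ℕ → ℕ → ℝ) (γ : ℝ → ℝ) {r : ℕ}
    (τ : Fin (r + 1) → ℝ) : Prop where
  array_mem : ∀ n k : ℕ, 1 ≤ n → k ≤ n → α n k ∈ Icc 0 β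
  curve_mem : ∀ t ∈ Icc (0 : ℝ) 1, γ t ∈ Icc 0 β
  partition_strictMono : StrictMono τ
  partition_zero : τ 0 = 0
  partition_last : τ (Fin.last r) = 1
  holder : ∀ l : Fin r, ∀ s ∈ Ioo (τ l.castSucc) (τ l.succ), ∀ t ∈ Ioo (τ l.castSucc) (τ l.succ),
    |γ t - γ s| ≤ C * |t - s| ^ θ
  approx : ∀ n : ℕ, 1 ≤ n → ∀ t ∈ Icc (0 : ℝ) 1,
    |α n ⌊(n : ℝ) * t⌋₊ - γ t| ≤ C * (n : ℝ) ^ (-θ)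

end Intermittent

open Intermittent

namespace Intermittent

/-! The idea is to freeze the parameter. By Hölder continuity, the parameters of the last N =
⌊n^(θ/4)⌋ steps differ from a fixed value a by O(n^((θ/4-1)θ)), provided this window crosses no τ_ℓ;
hence the margin of order n^(θ/4) after each τ_ℓ. Replacing these N operators by L_a costs at most N
times the parameter discrepancy in L¹, and L_a^N brings every regular density within K N^(-p) of the
invariant density of a. Both errors are O(n^(-pθ/4)).

Two estimates, uniform in the parameter, carry this. First, α ↦ L_α f is Lipschitz into L¹ for
regular f (`IsRegular.integral_abs_transfer_sub_transfer_le`), and every L_α with α ≤ β preserves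
regularity (`IsRegular.transfer`). Second, memory is lost at a polynomial rate (`exists_decay`), by
coupling. A decreasing remainder of mass at least ε below A x^(-β) must be at least ε/2 at some δ
that is a power of ε. The left preimages of 1 come near δ within O(δ^(-2)) steps, and this forces
the image of the remainder above a constant κ of order εδ² on all of (0,1]. Subtracting κ from both
images leaves decreasing remainders, so the step repeats until the mass is at most ε. The total time
is polynomial in 1/ε.

Loss of memory also yields the invariant density as the L¹ limit of L_a^n 1
(`exists_invariant_density`). As `srbMeasure` is an arbitrary choice among SRB measures, uniqueness
is needed too (`IsSRBMeasure.eq_withDensity`). -/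

/-! ### The left branch and its inverse -/

theorem leftBranch_eq {α y : ℝ} (hy : 0 ≤ y) : leftBranch α y = y * (1 + (2 * y) ^ α) := by
  rw [leftBranch, Real.mul_rpow (by norm_num) hy]

theorem leftBranchDeriv_eq {α y : ℝ} (hy : 0 ≤ y) :
    leftBranchDeriv α y = 1 + (1 + α) * (2 * y) ^ α := by
  rw [leftBranchDeriv, Real.mul_rpow (by norm_num) hy, mul_assoc]

theorem leftBranch_zero {α : ℝ} : leftBranch α 0 = 0 := by simp [leftBranch]

theorem leftBranch_half {α : ℝ} : leftBranch α (1 / 2) = 1 := by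
  rw [leftBranch_eq (by norm_num)]; norm_num

theorem continuous_leftBranch {α : ℝ} (hα : 0 ≤ α) : Continuous (leftBranch α) := by
  unfold leftBranch
  exact continuous_id.mul (continuous_const.add (continuous_const.mul
    (continuous_id.rpow_const fun _ => Or.inr hα)))

theorem strictMonoOn_leftBranch {α : ℝ} (hα : 0 ≤ α) : StrictMonoOn (leftBranch α) (Ici 0) := by
  intro x hx y hy hxy
  simp only [mem_Ici] at hx hy
  rw [leftBranch_eq hx, leftBranch_eq hy]
  have h1 : (2 * x) ^ α ≤ (2 * y) ^ α := by gcongr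
  have h2 : 0 ≤ (2 * x) ^ α := by positivity
  nlinarith

theorem hasDerivAt_leftBranch {α y : ℝ} (hy : 0 < y) :
    HasDerivAt (leftBranch α) (leftBranchDeriv α y) y := by
  have h := (hasDerivAt_id y).mul
    (((Real.hasDerivAt_rpow_const (p := α) (Or.inl hy.ne')).const_mul (2 ^ α)).const_add 1)
  refine HasDerivAt.congr_deriv (f := leftBranch α) h ?_
  rw [leftBranchDeriv, Real.rpow_sub_one hy.ne']
  simp only [id]
  field_simp
  ring

section Preimage

variable {α x : ℝ}

theorem leftPreimage_spec (hα : 0 ≤ α) (hx : x ∈ Icc (0 : ℝ) 1) :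
    leftPreimage α x ∈ Icc (0 : ℝ) (1 / 2) ∧ leftBranch α (leftPreimage α x) = x := by
  have h : ∃ a ∈ Icc (0 : ℝ) (1 / 2), leftBranch α a = x := by
    have := intermediate_value_Icc (by norm_num : (0 : ℝ) ≤ 1 / 2)
      (continuous_leftBranch hα).continuousOn
    rw [leftBranch_zero, leftBranch_half] at this
    exact this hx
  exact ⟨Function.invFunOn_mem h, Function.invFunOn_eq h⟩

theorem leftPreimage_pos (hα : 0 ≤ α) (hx : x ∈ Ioc (0 : ℝ) 1) : 0 < leftPreimage α x := by
  obtain ⟨h1, h2⟩ := leftPreimage_spec hα (Ioc_subset_Icc_self hx)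
  rcases h1.1.eq_or_lt with h | h
  · rw [← h, leftBranch_zero] at h2
    exact absurd h2 hx.1.ne
  · exact h

theorem leftPreimage_le_half (hα : 0 ≤ α) (hx : x ∈ Ioc (0 : ℝ) 1) : leftPreimage α x ≤ 1 / 2 :=
  (leftPreimage_spec hα (Ioc_subset_Icc_self hx)).1.2

theorem leftPreimage_mem (hα : 0 ≤ α) (hx : x ∈ Ioc (0 : ℝ) 1) :
    leftPreimage α x ∈ Ioc (0 : ℝ) 1 :=
  ⟨leftPreimage_pos hα hx, (leftPreimage_le_half hα hx).trans (by norm_num)⟩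

theorem leftPreimage_mul (hα : 0 ≤ α) (hx : x ∈ Ioc (0 : ℝ) 1) :
    leftPreimage α x * (1 + (2 * leftPreimage α x) ^ α) = x := by
  rw [← leftBranch_eq (leftPreimage_pos hα hx).le]
  exact (leftPreimage_spec hα (Ioc_subset_Icc_self hx)).2

theorem two_mul_leftPreimage_rpow_mem (hα : 0 ≤ α) (hx : x ∈ Ioc (0 : ℝ) 1) :
    (2 * leftPreimage α x) ^ α ∈ Ioc (0 : ℝ) 1 := by
  have h0 := leftPreimage_pos hα hx
  have h1 := leftPreimage_le_half hα hx
  exact ⟨by positivity, Real.rpow_le_one (by positivity) (by linarith) hα⟩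

theorem half_le_leftPreimage (hα : 0 ≤ α) (hx : x ∈ Ioc (0 : ℝ) 1) : x / 2 ≤ leftPreimage α x := by
  have h0 := leftPreimage_pos hα hx
  have h1 := two_mul_leftPreimage_rpow_mem hα hx
  have h2 := leftPreimage_mul hα hx
  nlinarith [h1.1, h1.2]

theorem leftPreimage_leftBranch (hα : 0 ≤ α) {y : ℝ} (hy : y ∈ Icc (0 : ℝ) (1 / 2)) :
    leftPreimage α (leftBranch α y) = y :=
  ((strictMonoOn_leftBranch hα).injOn.mono Icc_subset_Ici_self).leftInvOn_invFunOn hy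

theorem leftPreimage_mono (hα : 0 ≤ α) : MonotoneOn (leftPreimage α) (Ioc 0 1) := by
  intro x hx y hy hxy
  rw [← (strictMonoOn_leftBranch hα).le_iff_le (leftPreimage_pos hα hx).le
    (leftPreimage_pos hα hy).le, (leftPreimage_spec hα (Ioc_subset_Icc_self hx)).2,
    (leftPreimage_spec hα (Ioc_subset_Icc_self hy)).2]
  exact hxy

theorem rpow_le_two_mul_leftPreimage_rpow (hα : 0 ≤ α) (hx : x ∈ Ioc (0 : ℝ) 1) {b : ℝ}
    (hb : α ≤ b) : x ^ b ≤ (2 * leftPreimage α x) ^ α :=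
  (Real.rpow_le_rpow_of_exponent_ge hx.1 hx.2 hb).trans
    (Real.rpow_le_rpow hx.1.le (by linarith [half_le_leftPreimage hα hx]) hα)

theorem leftBranchDeriv_leftPreimage_pos (hα : 0 ≤ α) (hx : x ∈ Ioc (0 : ℝ) 1) :
    1 ≤ leftBranchDeriv α (leftPreimage α x) := by
  rw [leftBranchDeriv_eq (leftPreimage_pos hα hx).le]
  have := (two_mul_leftPreimage_rpow_mem hα hx).1
  nlinarith [mul_nonneg hα this.le]

end Preimage

theorem rightPreimage_mem {x : ℝ} (hx : x ∈ Ioc (0 : ℝ) 1) : x / 2 + 1 / 2 ∈ Ioc (0 : ℝ) 1 :=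
  ⟨by linarith [hx.1], by linarith [hx.2]⟩

/-! ### Duality between the map and its transfer operator -/

theorem measurable_pmMap (α : ℝ) : Measurable (pmMap α) := by
  unfold pmMap
  exact Measurable.ite measurableSet_Iio (by fun_prop) (by fun_prop)

theorem leb_eq : leb = volume.restrict (Ioc (0 : ℝ) 1) :=
  Measure.restrict_congr_set Ioc_ae_eq_Icc.symm

theorem leb_eq' : leb = volume.restrict (Ioo (0 : ℝ) 1) :=
  Measure.restrict_congr_set Ioo_ae_eq_Icc.symm

instance : IsProbabilityMeasure leb := ⟨by simp [leb]⟩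

theorem ae_leb_mem : ∀ᵐ x ∂leb, x ∈ Ioc (0 : ℝ) 1 := by
  rw [leb_eq]; exact ae_restrict_mem measurableSet_Ioc

theorem image_leftBranch {α : ℝ} (hα : 0 ≤ α) :
    leftBranch α '' Ioo 0 (1 / 2) = Ioo 0 1 := by
  ext x
  constructor
  · rintro ⟨y, hy, rfl⟩
    refine ⟨?_, ?_⟩
    · simpa [leftBranch_zero] using
        strictMonoOn_leftBranch hα (mem_Ici.2 (le_refl (0 : ℝ))) (mem_Ici.2 hy.1.le) hy.1
    · have := strictMonoOn_leftBranch hα (mem_Ici.2 hy.1.le)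
        (mem_Ici.2 (by norm_num : (0 : ℝ) ≤ 1 / 2)) hy.2
      rwa [leftBranch_half] at this
  · intro hx
    have hx' : x ∈ Ioc (0 : ℝ) 1 := Ioo_subset_Ioc_self hx
    have h2 := (leftPreimage_spec hα (Ioc_subset_Icc_self hx')).2
    refine ⟨leftPreimage α x, ⟨leftPreimage_pos hα hx',
      lt_of_le_of_ne (leftPreimage_le_half hα hx') fun h => ?_⟩, h2⟩
    rw [h, leftBranch_half] at h2
    exact hx.2.ne' h2

/-- Substitute x = T y on the left branch: the Jacobian cancels the denominator in the transfer
operator. -/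
theorem lintegral_leftBranch {α : ℝ} (hα : 0 ≤ α) (f : ℝ → ℝ) (φ : ℝ → ENNReal) :
    ∫⁻ x in Ioo 0 1, φ x *
      ENNReal.ofReal (f (leftPreimage α x) / leftBranchDeriv α (leftPreimage α x)) =
    ∫⁻ y in Ioo 0 (1 / 2), φ (pmMap α y) * ENNReal.ofReal (f y) := by
  rw [← image_leftBranch hα, lintegral_image_eq_lintegral_abs_deriv_mul measurableSet_Ioo
    (fun y hy => (hasDerivAt_leftBranch hy.1).hasDerivWithinAt)
    ((strictMonoOn_leftBranch hα).injOn.mono fun y hy => hy.1.le)]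
  refine setLIntegral_congr_fun measurableSet_Ioo fun y hy => ?_
  have hd : 0 < leftBranchDeriv α y := by
    rw [leftBranchDeriv_eq hy.1.le]
    have : 0 ≤ (2 * y) ^ α := by have := hy.1; positivity
    positivity
  simp only [leftPreimage_leftBranch hα (Ioo_subset_Icc_self hy), pmMap, if_pos hy.2]
  rw [abs_of_pos hd, mul_left_comm, ← ENNReal.ofReal_mul hd.le, mul_div_cancel₀ _ hd.ne']
  rfl

theorem lintegral_rightBranch {α : ℝ} (f : ℝ → ℝ) (φ : ℝ → ENNReal) :
    ∫⁻ x in Ioo 0 1, φ x * ENNReal.ofReal (f (x / 2 + 1 / 2) / 2) =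
    ∫⁻ y in Ioo (1 / 2) 1, φ (pmMap α y) * ENNReal.ofReal (f y) := by
  have him : (fun y : ℝ => 2 * y - 1) '' Ioo (1 / 2) 1 = Ioo 0 1 := by
    ext x
    constructor
    · rintro ⟨y, hy, rfl⟩
      exact ⟨by linarith [hy.1], by linarith [hy.2]⟩
    · intro hx
      exact ⟨x / 2 + 1 / 2, ⟨by linarith [hx.1], by linarith [hx.2]⟩, by ring⟩
  have hd : ∀ y ∈ Ioo (1 / 2 : ℝ) 1,
      HasDerivWithinAt (fun y : ℝ => 2 * y - 1) 2 (Ioo (1 / 2) 1) y := fun y _ => by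
    simpa using (((hasDerivAt_id y).const_mul 2).sub_const 1).hasDerivWithinAt
  rw [← him, lintegral_image_eq_lintegral_abs_deriv_mul measurableSet_Ioo hd
    (fun a _ b _ h => by simpa using h)]
  refine setLIntegral_congr_fun measurableSet_Ioo fun y hy => ?_
  have h1 : (2 * y - 1) / 2 + 1 / 2 = y := by ring
  simp only [h1, pmMap, if_neg (not_lt.2 hy.1.le)]
  rw [mul_left_comm, ← ENNReal.ofReal_mul (abs_nonneg _), abs_of_pos (by norm_num : (0 : ℝ) < 2),
    mul_div_cancel₀ _ (by norm_num : (2 : ℝ) ≠ 0)]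

theorem quasiMeasurePreserving_rightPreimage :
    Measure.QuasiMeasurePreserving (fun x : ℝ => x / 2 + 1 / 2) leb leb := by
  have h : Measure.QuasiMeasurePreserving (fun x : ℝ => x / 2 + 1 / 2) volume volume := by
    have h1 : Measure.QuasiMeasurePreserving (fun x : ℝ => x * (1 / 2)) volume volume := by
      refine ⟨by fun_prop, ?_⟩
      rw [Real.map_volume_mul_right (by norm_num)]
      exact Measure.smul_absolutelyContinuous
    have h2 := (measurePreserving_add_right volume (1 / 2 : ℝ)).quasiMeasurePreserving.comp h1
    convert h2 using 1
    funext x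
    simp [div_eq_mul_inv]
  rw [leb_eq]
  exact h.restrict fun x hx => rightPreimage_mem hx

/-- Split the interval at the null point 1/2 and change variables on each branch. Indicators φ give
the pushforward formula and φ = 1 conservation of mass. No monotonicity of f is assumed, because the
L¹ contraction needs the case |f - g|. -/
theorem lintegral_transfer {α : ℝ} (hα : 0 ≤ α) {f : ℝ → ℝ} (hf : ∀ x ∈ Ioc (0 : ℝ) 1, 0 ≤ f x)
    (hm : AEMeasurable f leb) {φ : ℝ → ENNReal} (hφ : Measurable φ) :
    ∫⁻ x, φ x * ENNReal.ofReal (transfer α f x) ∂leb =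
      ∫⁻ x, φ (pmMap α x) * ENNReal.ofReal (f x) ∂leb := by
  have hsum : ∫⁻ x, φ x * ENNReal.ofReal (transfer α f x) ∂leb =
      ∫⁻ x, (φ x * ENNReal.ofReal (f (leftPreimage α x) / leftBranchDeriv α (leftPreimage α x)) +
        φ x * ENNReal.ofReal (f (x / 2 + 1 / 2) / 2)) ∂leb := by
    refine lintegral_congr_ae ?_
    filter_upwards [ae_leb_mem] with x hx
    rw [← mul_add, transfer, ENNReal.ofReal_add]
    · exact div_nonneg (hf _ (leftPreimage_mem hα hx))
        (zero_le_one.trans (leftBranchDeriv_leftPreimage_pos hα hx))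
    · exact div_nonneg (hf _ (rightPreimage_mem hx)) (by norm_num)
  -- Additivity needs measurability of one summand only; choosing the right branch avoids the
  -- question for f ∘ `leftPreimage α`.
  have hmr : AEMeasurable (fun x => φ x * ENNReal.ofReal (f (x / 2 + 1 / 2) / 2)) leb :=
    hφ.aemeasurable.mul
      ((hm.comp_quasiMeasurePreserving quasiMeasurePreserving_rightPreimage).div_const
        2).ennreal_ofReal
  rw [hsum, lintegral_add_right' _ hmr, leb_eq', lintegral_leftBranch hα,
    lintegral_rightBranch (α := α)]
  have hu : Ioo (0 : ℝ) 1 =ᵐ[volume] (Ioo 0 (1 / 2) ∪ Ioo (1 / 2) 1 : Set ℝ) := by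
    have h1 : (Ioo 0 (1 / 2) ∪ Ico (1 / 2) 1 : Set ℝ) = Ioo 0 1 :=
      Ioo_union_Ico_eq_Ioo (by norm_num) (by norm_num)
    rw [← h1]
    exact (ae_eq_refl _).union Ioo_ae_eq_Ico.symm
  rw [setLIntegral_congr hu, lintegral_union measurableSet_Ioo]
  exact Set.disjoint_left.2 fun x hx hx' => lt_asymm hx.2 hx'.1

theorem map_pmMap_withDensity {α : ℝ} (hα : 0 ≤ α) {f : ℝ → ℝ}
    (hf : ∀ x ∈ Ioc (0 : ℝ) 1, 0 ≤ f x) (hm : AEMeasurable f leb) :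
    (leb.withDensity fun x => ENNReal.ofReal (f x)).map (pmMap α) =
      leb.withDensity fun x => ENNReal.ofReal (transfer α f x) := by
  ext s hs
  have hs' := measurable_pmMap α hs
  rw [Measure.map_apply (measurable_pmMap α) hs, withDensity_apply _ hs', withDensity_apply _ hs,
    ← lintegral_indicator hs, ← lintegral_indicator hs']
  have h := lintegral_transfer hα hf hm (φ := s.indicator 1)
    (measurable_one.indicator hs)
  convert h.symm using 2 <;> funext x
  · by_cases hx : pmMap α x ∈ s <;> simp [indicator, hx]
  · by_cases hx : x ∈ s <;> simp [indicator, hx]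

/-! ### Classes of densities preserved by the transfer operators -/

theorem integrable_rpow_leb {b : ℝ} (hb : b < 1) : Integrable (fun x : ℝ => x ^ (-b)) leb := by
  rw [leb_eq]
  exact (intervalIntegrable_iff_integrableOn_Ioc_of_le zero_le_one).1
    (intervalIntegral.intervalIntegrable_rpow' (by linarith))

theorem integral_rpow_leb {b : ℝ} (hb : b < 1) : ∫ x : ℝ, x ^ (-b) ∂leb = 1 / (1 - b) := by
  rw [leb_eq, ← intervalIntegral.integral_of_le zero_le_one, integral_rpow (Or.inl (by linarith))]
  rw [Real.one_rpow, Real.zero_rpow (by linarith)]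
  ring

/-- Nonnegative, decreasing, integrable functions on `(0,1]`. -/
structure IsDecr (f : ℝ → ℝ) : Prop where
  nonneg : ∀ x ∈ Ioc (0 : ℝ) 1, 0 ≤ f x
  anti : AntitoneOn f (Ioc 0 1)
  integrable : Integrable f leb

/-- Functions in `IsDecr` that are at most `A * x ^ (-β)`. -/
structure IsTame (β A : ℝ) (f : ℝ → ℝ) : Prop extends IsDecr f where
  le_bound : ∀ x ∈ Ioc (0 : ℝ) 1, f x ≤ A * x ^ (-β)

/-- Normalised functions in `IsTame` for which `x ^ (β + 1) * f x` is increasing. -/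
structure IsRegular (β A : ℝ) (f : ℝ → ℝ) : Prop extends IsTame β A f where
  mono : MonotoneOn (fun x : ℝ => x ^ (β + 1) * f x) (Ioc 0 1)
  integral_eq : ∫ x, f x ∂leb = 1

theorem aemeasurable_of_antitoneOn {f : ℝ → ℝ} (hf : AntitoneOn f (Ioc 0 1)) :
    AEMeasurable f leb := by
  rw [leb_eq]; exact aemeasurable_restrict_of_antitoneOn measurableSet_Ioc hf

theorem transfer_sub (α : ℝ) (f g : ℝ → ℝ) (x : ℝ) :
    transfer α (fun x => f x - g x) x = transfer α f x - transfer α g x := by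
  simp only [transfer]; ring

theorem transfer_nonneg {α : ℝ} (hα : 0 ≤ α) {f : ℝ → ℝ} (hf : ∀ x ∈ Ioc (0 : ℝ) 1, 0 ≤ f x)
    {x : ℝ} (hx : x ∈ Ioc (0 : ℝ) 1) : 0 ≤ transfer α f x :=
  add_nonneg (div_nonneg (hf _ (leftPreimage_mem hα hx))
    (zero_le_one.trans (leftBranchDeriv_leftPreimage_pos hα hx)))
    (div_nonneg (hf _ (rightPreimage_mem hx)) zero_le_two)

theorem transfer_antitoneOn {α : ℝ} (hα : 0 ≤ α) {f : ℝ → ℝ}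
    (hf : ∀ x ∈ Ioc (0 : ℝ) 1, 0 ≤ f x) (ha : AntitoneOn f (Ioc 0 1)) :
    AntitoneOn (transfer α f) (Ioc 0 1) := by
  intro x hx x' hx' hxx
  have hy := leftPreimage_mono hα hx hx' hxx
  have h0 := leftPreimage_pos hα hx
  refine add_le_add (div_le_div₀ (hf _ (leftPreimage_mem hα hx))
    (ha (leftPreimage_mem hα hx) (leftPreimage_mem hα hx') hy)
    (zero_lt_one.trans_le (leftBranchDeriv_leftPreimage_pos hα hx)) ?_) ?_
  · rw [leftBranchDeriv_eq h0.le, leftBranchDeriv_eq (h0.le.trans hy)]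
    gcongr
  · have := ha (rightPreimage_mem hx) (rightPreimage_mem hx') (by linarith)
    linarith

theorem lintegral_transfer_eq {α : ℝ} (hα : 0 ≤ α) {f : ℝ → ℝ}
    (hf : ∀ x ∈ Ioc (0 : ℝ) 1, 0 ≤ f x) (hm : AEMeasurable f leb) :
    ∫⁻ x, ENNReal.ofReal (transfer α f x) ∂leb = ∫⁻ x, ENNReal.ofReal (f x) ∂leb := by
  simpa using lintegral_transfer hα hf hm (φ := 1) measurable_one

theorem IsDecr.transfer {α : ℝ} (hα : 0 ≤ α) {f : ℝ → ℝ} (hf : IsDecr f) :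
    IsDecr (transfer α f) := by
  have ha := transfer_antitoneOn hα hf.nonneg hf.anti
  refine ⟨fun x => transfer_nonneg hα hf.nonneg, ha,
    (aemeasurable_of_antitoneOn ha).aestronglyMeasurable, ?_⟩
  have h0 : 0 ≤ᵐ[leb] Intermittent.transfer α f := by
    filter_upwards [ae_leb_mem] with x hx using transfer_nonneg hα hf.nonneg hx
  rw [hasFiniteIntegral_iff_ofReal h0,
    lintegral_transfer_eq hα hf.nonneg hf.integrable.aemeasurable,
    ← hasFiniteIntegral_iff_ofReal]
  · exact hf.integrable.2
  · filter_upwards [ae_leb_mem] with x hx using hf.nonneg x hx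

theorem IsDecr.integral_transfer {α : ℝ} (hα : 0 ≤ α) {f : ℝ → ℝ} (hf : IsDecr f) :
    ∫ x, Intermittent.transfer α f x ∂leb = ∫ x, f x ∂leb := by
  rw [integral_eq_lintegral_of_nonneg_ae _ (hf.transfer hα).integrable.aestronglyMeasurable,
    integral_eq_lintegral_of_nonneg_ae _ hf.integrable.aestronglyMeasurable,
    lintegral_transfer_eq hα hf.nonneg hf.integrable.aemeasurable]
  · filter_upwards [ae_leb_mem] with x hx using hf.nonneg x hx
  · filter_upwards [ae_leb_mem] with x hx using transfer_nonneg hα hf.nonneg hx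

/-- Pointwise |L(f - g)| ≤ L|f - g|, and L preserves the integral of |f - g|. -/
theorem IsDecr.integral_abs_transfer_sub_le {α : ℝ} (hα : 0 ≤ α) {f g : ℝ → ℝ} (hf : IsDecr f)
    (hg : IsDecr g) :
    ∫ x, |Intermittent.transfer α f x - Intermittent.transfer α g x| ∂leb ≤
      ∫ x, |f x - g x| ∂leb := by
  have hi : Integrable (fun x => |f x - g x|) leb := (hf.integrable.sub hg.integrable).abs
  have hi' : Integrable (fun x => |Intermittent.transfer α f x - Intermittent.transfer α g x|)
    leb := ((hf.transfer hα).integrable.sub (hg.transfer hα).integrable).abs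
  rw [integral_eq_lintegral_of_nonneg_ae (ae_of_all _ fun x => abs_nonneg _)
    hi'.aestronglyMeasurable, integral_eq_lintegral_of_nonneg_ae (ae_of_all _ fun x => abs_nonneg _)
    hi.aestronglyMeasurable]
  refine ENNReal.toReal_mono ?_ ?_
  · exact hi.lintegral_lt_top.ne
  · rw [← lintegral_transfer_eq hα (f := fun x => |f x - g x|) (fun x _ => abs_nonneg _)
      hi.aemeasurable]
    refine lintegral_mono_ae ?_
    filter_upwards [ae_leb_mem] with x hx
    refine ENNReal.ofReal_le_ofReal ?_
    rw [← transfer_sub]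
    simp only [Intermittent.transfer]
    refine (abs_add_le _ _).trans_eq ?_
    rw [abs_div, abs_div,
      abs_of_pos (zero_lt_one.trans_le (leftBranchDeriv_leftPreimage_pos hα hx)),
      abs_of_pos (zero_lt_two' ℝ)]

/-- A decreasing nonnegative f dominates f(x) times the indicator of (0,x]. -/
theorem IsDecr.mul_le_integral {f : ℝ → ℝ} (hf : IsDecr f) {x : ℝ} (hx : x ∈ Ioc (0 : ℝ) 1) :
    x * f x ≤ ∫ y, f y ∂leb := by
  have h : ∫ y, (Ioc 0 x).indicator (fun _ => f x) y ∂leb = x * f x := by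
    rw [integral_indicator measurableSet_Ioc, leb_eq, Measure.restrict_restrict measurableSet_Ioc,
      inter_eq_left.2 (Ioc_subset_Ioc_right hx.2)]
    simp [hx.1.le]
  rw [← h]
  refine integral_mono_ae ((integrable_const _).indicator measurableSet_Ioc) hf.integrable ?_
  filter_upwards [ae_leb_mem] with y hy
  by_cases hyx : y ∈ Ioc 0 x
  · rw [indicator_of_mem hyx]; exact hf.anti hy hx hyx.2
  · rw [indicator_of_notMem hyx]; exact hf.nonneg y hy

/-- Write 1 + v = (1 + u)(1 + s) and apply Bernoulli to (1 + s)^b; b ≥ 1 + α makes the gain outweigh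
the growth of the denominator. -/
theorem one_add_rpow_ratio_mono {α b u v : ℝ} (hα : 0 ≤ α) (hb : 1 + α ≤ b) (hu : 0 ≤ u)
    (huv : u ≤ v) :
    (1 + u) ^ b / (1 + (1 + α) * u) ≤ (1 + v) ^ b / (1 + (1 + α) * v) := by
  have hu1 : 0 < 1 + u := by linarith
  have hc : 0 < 1 + (1 + α) * u := by positivity
  have hd : 0 < 1 + (1 + α) * v := by have := hu.trans huv; positivity
  rw [div_le_div_iff₀ hc hd]
  have hs : 0 ≤ (v - u) / (1 + u) := div_nonneg (by linarith) hu1.le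
  have h1 := one_add_mul_self_le_rpow_one_add (s := (v - u) / (1 + u)) (p := b) (by linarith)
    (by linarith)
  have h2 : 1 + v = (1 + u) * (1 + (v - u) / (1 + u)) := by field_simp; ring
  rw [h2, Real.mul_rpow hu1.le (by linarith), mul_assoc]
  refine mul_le_mul_of_nonneg_left ?_ (Real.rpow_nonneg hu1.le _)
  refine le_trans ?_ (mul_le_mul_of_nonneg_right h1 hc.le)
  set s := (v - u) / (1 + u) with hsdef
  have h3 : v = u + s * (1 + u) := by rw [hsdef]; field_simp; ring
  have h4 : (1 + α) * (s * (1 + u)) ≤ b * s * (1 + (1 + α) * u) := by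
    have : (1 + α) * (s * (1 + u)) ≤ b * (s * (1 + u)) :=
      mul_le_mul_of_nonneg_right hb (by positivity)
    have h5 : 0 ≤ b * s * (α * u) := by have : 0 ≤ b := by linarith
                                        positivity
    nlinarith
  rw [h3]
  nlinarith

/-- With y the left preimage and u = (2y)^α, the relation x = y(1 + u) turns x^(β+1) times the left
term into y^(β+1) f(y) times the ratio of `one_add_rpow_ratio_mono`. The right term is treated
likewise with ξ = x/2 + 1/2. All factors are nonnegative and increasing. -/
theorem transfer_mono {α β : ℝ} (hα : 0 ≤ α) (hαβ : α ≤ β) {f : ℝ → ℝ}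
    (hf : ∀ x ∈ Ioc (0 : ℝ) 1, 0 ≤ f x)
    (hm : MonotoneOn (fun x : ℝ => x ^ (β + 1) * f x) (Ioc 0 1)) :
    MonotoneOn (fun x : ℝ => x ^ (β + 1) * transfer α f x) (Ioc 0 1) := by
  have key : ∀ x ∈ Ioc (0 : ℝ) 1, x ^ (β + 1) * transfer α f x =
      (leftPreimage α x ^ (β + 1) * f (leftPreimage α x)) *
        ((1 + (2 * leftPreimage α x) ^ α) ^ (β + 1) /
          (1 + (1 + α) * (2 * leftPreimage α x) ^ α)) +
      (x / (x / 2 + 1 / 2)) ^ (β + 1) *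
        ((x / 2 + 1 / 2) ^ (β + 1) * f (x / 2 + 1 / 2)) / 2 := by
    intro x hx
    have h0 := leftPreimage_pos hα hx
    have hu := (two_mul_leftPreimage_rpow_mem hα hx).1
    have h1 : x ^ (β + 1) = leftPreimage α x ^ (β + 1) *
        (1 + (2 * leftPreimage α x) ^ α) ^ (β + 1) := by
      rw [← Real.mul_rpow h0.le (by linarith), leftPreimage_mul hα hx]
    have hξ := (rightPreimage_mem hx).1
    have h2 : x ^ (β + 1) = (x / (x / 2 + 1 / 2)) ^ (β + 1) * (x / 2 + 1 / 2) ^ (β + 1) := by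
      rw [← Real.mul_rpow (div_nonneg hx.1.le hξ.le) hξ.le, div_mul_cancel₀ _ hξ.ne']
    rw [transfer, mul_add, leftBranchDeriv_eq h0.le]
    congr 1
    · rw [h1]; ring
    · rw [h2]; ring
  intro x hx x' hx' hxx
  simp only [key x hx, key x' hx']
  have hy := leftPreimage_mono hα hx hx' hxx
  have h0 := leftPreimage_pos hα hx
  have hu := (two_mul_leftPreimage_rpow_mem hα hx).1
  have hu' := (two_mul_leftPreimage_rpow_mem hα hx').1
  have hξ := rightPreimage_mem hx
  have hξ' := rightPreimage_mem hx'
  refine add_le_add (mul_le_mul (hm (leftPreimage_mem hα hx) (leftPreimage_mem hα hx') hy)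
    (one_add_rpow_ratio_mono hα (by linarith) hu.le (by gcongr)) (by positivity)
    (mul_nonneg (Real.rpow_nonneg (leftPreimage_pos hα hx').le _)
      (hf _ (leftPreimage_mem hα hx')))) ?_
  refine div_le_div_of_nonneg_right (mul_le_mul (Real.rpow_le_rpow
    (div_nonneg hx.1.le hξ.1.le) ?_ (by linarith)) (hm hξ hξ' (by linarith))
    (mul_nonneg (Real.rpow_nonneg hξ.1.le _) (hf _ hξ))
    (Real.rpow_nonneg (div_nonneg hx'.1.le hξ'.1.le) _)) zero_le_two
  rw [div_le_div_iff₀ hξ.1 hξ'.1]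
  nlinarith

/-- For the bound A x^(-β): the right term is at most 1, since ξ f(ξ) ≤ 1 and ξ ≥ 1/2. By Bernoulli
the left term is at most A x^(-β) (1 - (1-β)u/2), and u ≥ x^β makes this saving at least A(1-β)/2 ≥
1, which absorbs the right term. -/
theorem IsRegular.transfer {α β A : ℝ} (hα : α ∈ Icc 0 β) (hβ : β < 1) (hA : 2 ≤ A * (1 - β))
    {f : ℝ → ℝ} (hf : IsRegular β A f) : IsRegular β A (transfer α f) := by
  obtain ⟨hα0, hαβ⟩ := hα
  have hβ0 : 0 ≤ β := hα0.trans hαβ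
  refine ⟨⟨hf.toIsDecr.transfer hα0, fun x hx => ?_⟩, transfer_mono hα0 hαβ hf.nonneg hf.mono,
    (hf.toIsDecr.integral_transfer hα0).trans hf.integral_eq⟩
  have hA0 : 0 < A := by by_contra! h; nlinarith
  have hξ := rightPreimage_mem hx
  have h1 : f (x / 2 + 1 / 2) / 2 ≤ 1 := by
    have := hf.toIsDecr.mul_le_integral hξ
    rw [hf.integral_eq] at this
    have h2 := hf.nonneg _ hξ
    nlinarith [hx.1]
  have hy := leftPreimage_mem hα0 hx
  have hu := two_mul_leftPreimage_rpow_mem hα0 hx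
  have hux := rpow_le_two_mul_leftPreimage_rpow hα0 hx hαβ
  have hyx := leftPreimage_mul hα0 hx
  have hfy := hf.le_bound _ hy
  rw [Intermittent.transfer, leftBranchDeriv_eq hy.1.le]
  set y := leftPreimage α x
  set u := (2 * y) ^ α
  have hxβ : 0 < x ^ β := Real.rpow_pos_of_pos hx.1 _
  have hyβ : 0 < y ^ β := Real.rpow_pos_of_pos hy.1 _
  have hD : 0 < 1 + (1 + α) * u := by nlinarith [hu.1, mul_nonneg hα0 hu.1.le]
  have hbern : (1 + u) ^ β ≤ 1 + β * u :=
    rpow_one_add_le_one_add_mul_self (by linarith [hu.1]) hβ0 hβ.le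
  have hx' : x ^ β = y ^ β * (1 + u) ^ β := by
    rw [← Real.mul_rpow hy.1.le (by linarith [hu.1]), hyx]
  have h3 : f y / (1 + (1 + α) * u) ≤ A * x ^ (-β) * ((1 + β * u) / (1 + (1 + α) * u)) := by
    rw [mul_div_assoc']
    refine div_le_div_of_nonneg_right (hfy.trans ?_) hD.le
    rw [mul_assoc]
    refine mul_le_mul_of_nonneg_left ?_ hA0.le
    rw [Real.rpow_neg hy.1.le, Real.rpow_neg hx.1.le, hx', mul_inv, mul_assoc]
    refine le_mul_of_one_le_right (inv_nonneg.2 hyβ.le) ?_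
    rw [← div_eq_inv_mul, one_le_div (Real.rpow_pos_of_pos (by linarith [hu.1]) _)]
    exact hbern
  have h4 : (1 + β * u) / (1 + (1 + α) * u) ≤ 1 - (1 - β) * u / 2 := by
    rw [div_le_iff₀ hD]
    have h5 : 0 ≤ α * u := mul_nonneg hα0 hu.1.le
    have h6 : 0 ≤ 1 - (1 - β) * u / 2 := by nlinarith [hu.1, hu.2]
    nlinarith [hu.1, hu.2, mul_nonneg h6 h5, mul_nonneg (mul_nonneg (sub_nonneg.2 hβ.le) hu.1.le)
      (sub_nonneg.2 hu.2)]
  have h7 : 1 ≤ A * x ^ (-β) * ((1 - β) * u / 2) := by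
    have : x ^ (-β) * x ^ β = 1 := by
      rw [Real.rpow_neg hx.1.le, inv_mul_cancel₀ hxβ.ne']
    have hneg : 0 < x ^ (-β) := Real.rpow_pos_of_pos hx.1 _
    have h8 : 1 ≤ x ^ (-β) * u := by rw [← this]; gcongr
    nlinarith
  have h9 : 0 ≤ A * x ^ (-β) := mul_nonneg hA0.le (Real.rpow_nonneg hx.1.le _)
  nlinarith [mul_le_mul_of_nonneg_left h4 h9]

theorem InCone.isRegular {β A : ℝ} (hβ : β ∈ Ioo (0 : ℝ) 1) (hA : 6 ≤ A) {h : ℝ → ℝ}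
    (hh : InCone β h) (h1 : ∫ x, h x ∂leb = 1) : IsRegular β A h := by
  refine ⟨⟨⟨hh.nonneg, hh.decreasing, hh.integrable⟩, fun x hx => ?_⟩, hh.increasing, h1⟩
  refine (hh.le_bound x hx).trans ?_
  rw [h1, mul_one]
  refine mul_le_mul_of_nonneg_right ?_ (Real.rpow_nonneg hx.1.le _)
  have : (2 : ℝ) ^ β ≤ 2 ^ (1 : ℝ) := Real.rpow_le_rpow_of_exponent_le (by norm_num) hβ.2.le
  rw [Real.rpow_one] at this
  nlinarith [hβ.1, hβ.2, Real.rpow_pos_of_pos (zero_lt_two' ℝ) β]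

theorem isRegular_one {β A : ℝ} (hβ : 0 ≤ β) (hA : 1 ≤ A) : IsRegular β A fun _ => 1 := by
  refine ⟨⟨⟨fun _ _ => zero_le_one, fun _ _ _ _ _ => le_rfl, integrable_const _⟩,
    fun x hx => ?_⟩, fun x hx y hy hxy => ?_, by simp⟩
  · have := Real.one_le_rpow_of_pos_of_le_one_of_nonpos hx.1 hx.2 (neg_nonpos.2 hβ)
    nlinarith
  · simpa using Real.rpow_le_rpow hx.1.le hxy (by linarith)

/-! ### Lipschitz dependence of the transfer operator on the parameter -/

/-- Monotonicity of x^(β+1) f gives f(b) ≥ (a/b)^(β+1) f(a); Bernoulli linearises the power. This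
replaces a derivative bound on f. -/
theorem IsRegular.sub_le {β A : ℝ} (hβ : 0 ≤ β) {f : ℝ → ℝ} (hf : IsRegular β A f) {a b : ℝ}
    (ha : a ∈ Ioc (0 : ℝ) 1) (hb : b ∈ Ioc (0 : ℝ) 1) (hab : a ≤ b) :
    f a - f b ≤ (1 + β) * (1 - a / b) * f a := by
  have h1 := hf.mono ha hb hab
  have hb' : 0 < b ^ (β + 1) := Real.rpow_pos_of_pos hb.1 _
  have hq : 0 < a / b := div_pos ha.1 hb.1
  have h2 := one_add_mul_self_le_rpow_one_add (s := a / b - 1) (p := β + 1) (by linarith)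
    (by linarith)
  rw [add_sub_cancel, Real.div_rpow ha.1.le hb.1.le, le_div_iff₀ hb'] at h2
  have h3 := hf.nonneg a ha
  have h4 : (1 + (β + 1) * (a / b - 1)) * f a ≤ f b := by
    refine le_of_mul_le_mul_right (a := b ^ (β + 1)) ?_ hb'
    calc (1 + (β + 1) * (a / b - 1)) * f a * b ^ (β + 1)
        = (1 + (β + 1) * (a / b - 1)) * b ^ (β + 1) * f a := by ring
      _ ≤ a ^ (β + 1) * f a := mul_le_mul_of_nonneg_right h2 h3
      _ ≤ b ^ (β + 1) * f b := h1
      _ = _ := mul_comm _ _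
  linarith

/-- Differentiating in the exponent costs |log w|, traded here for the small power w^(-s)/s. -/
theorem rpow_sub_rpow_le {w a b s : ℝ} (hw : w ∈ Ioc (0 : ℝ) 1) (ha : 0 ≤ a) (hab : a ≤ b)
    (hs : 0 < s) : w ^ a - w ^ b ≤ (b - a) * (w ^ (-s) / s) := by
  have h1 : w ^ b = w ^ a * w ^ (b - a) := by
    rw [← Real.rpow_add hw.1, add_sub_cancel]
  have h2 : 1 + (b - a) * Real.log w ≤ w ^ (b - a) := by
    rw [Real.rpow_def_of_pos hw.1, mul_comm, add_comm]
    exact Real.add_one_le_exp _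
  have h3 : -Real.log w ≤ w ^ (-s) / s := by
    have := Real.log_le_rpow_div (inv_nonneg.2 hw.1.le) hs
    rwa [Real.log_inv, Real.inv_rpow hw.1.le, ← Real.rpow_neg hw.1.le] at this
  have h4 : w ^ a ≤ 1 := Real.rpow_le_one hw.1.le hw.2 ha
  have h5 : 0 < w ^ a := Real.rpow_pos_of_pos hw.1 _
  have h6 : w ^ (b - a) ≤ 1 := Real.rpow_le_one hw.1.le hw.2 (by linarith)
  calc w ^ a - w ^ b = w ^ a * (1 - w ^ (b - a)) := by rw [h1]; ring
    _ ≤ 1 * (1 - w ^ (b - a)) := mul_le_mul_of_nonneg_right h4 (by linarith)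
    _ ≤ (b - a) * (-Real.log w) := by linarith
    _ ≤ _ := mul_le_mul_of_nonneg_left h3 (by linarith)

/-- The right terms cancel. Raising the parameter moves the left preimage from y up to y' and lowers
u = (2y)^α to u'. Since y(1 + u) = y'(1 + u'), both the relative displacement 1 - y/y' and the
change of the derivative are controlled by u - u' and α' - α, and u - u' ≤ (α' - α) x^(-s)/s. -/
theorem IsRegular.abs_transfer_sub_le {α α' β A s : ℝ} (hα : 0 ≤ α) (hαα : α ≤ α') (hα' : α' ≤ β)
    (hβ : β < 1) (hA : 0 ≤ A) (hs : 0 < s) {f : ℝ → ℝ} (hf : IsRegular β A f) {x : ℝ}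
    (hx : x ∈ Ioc (0 : ℝ) 1) :
    |Intermittent.transfer α f x - Intermittent.transfer α' f x| ≤
      (α' - α) * (2 * A * (1 + 4 / s)) * x ^ (-(β + s)) := by
  have hα0' := hα.trans hαα
  have hβ0 := hα0'.trans hα'
  have hy := leftPreimage_mem hα hx
  have hy' := leftPreimage_mem hα0' hx
  have hu := two_mul_leftPreimage_rpow_mem hα hx
  have hu' := two_mul_leftPreimage_rpow_mem hα0' hx
  have hyx := leftPreimage_mul hα hx
  have hyx' := leftPreimage_mul hα0' hx
  have hxy := half_le_leftPreimage hα hx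
  have hxy' := half_le_leftPreimage hα0' hx
  have hhalf := leftPreimage_le_half hα hx
  have hD1 := leftBranchDeriv_leftPreimage_pos hα hx
  have hD1' := leftBranchDeriv_leftPreimage_pos hα0' hx
  have hw : 2 * leftPreimage α x ∈ Ioc (0 : ℝ) 1 := ⟨by linarith [hy.1], by linarith⟩
  have hyy : leftPreimage α x ≤ leftPreimage α' x := by
    rw [← (strictMonoOn_leftBranch hα0').le_iff_le hy.1.le hy'.1.le, leftBranch_eq hy.1.le,
      leftBranch_eq hy'.1.le, hyx']
    refine le_trans ?_ hyx.le
    exact mul_le_mul_of_nonneg_left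
      (add_le_add_right (Real.rpow_le_rpow_of_exponent_ge hw.1 hw.2 hαα) _) hy.1.le
  have hdiff : (2 * leftPreimage α x) ^ α - (2 * leftPreimage α' x) ^ α' ≤
      (α' - α) * (x ^ (-s) / s) := by
    have h1 : (2 * leftPreimage α x) ^ α' ≤ (2 * leftPreimage α' x) ^ α' := by
      have := hw.1.le
      gcongr
    have h2 := rpow_sub_rpow_le hw hα hαα hs
    have h3 : (2 * leftPreimage α x) ^ (-s) ≤ x ^ (-s) :=
      Real.rpow_le_rpow_of_nonpos hx.1 (by linarith) (by linarith)
    have h4 : (α' - α) * ((2 * leftPreimage α x) ^ (-s) / s) ≤ (α' - α) * (x ^ (-s) / s) :=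
      mul_le_mul_of_nonneg_left (div_le_div_of_nonneg_right h3 hs.le) (by linarith)
    linarith
  have hbd : ∀ z ∈ Ioc (0 : ℝ) 1, x / 2 ≤ z → f z ≤ 2 * A * x ^ (-β) := by
    intro z hz hxz
    refine (hf.le_bound z hz).trans ?_
    have h1 : z ^ (-β) ≤ (x / 2) ^ (-β) :=
      Real.rpow_le_rpow_of_nonpos (by linarith [hx.1]) hxz (by linarith)
    have h2 : (x / 2) ^ (-β) ≤ 2 * x ^ (-β) := by
      rw [Real.div_rpow hx.1.le zero_le_two, Real.rpow_neg zero_le_two, div_inv_eq_mul, mul_comm]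
      refine mul_le_mul_of_nonneg_right ?_ (Real.rpow_nonneg hx.1.le _)
      simpa using Real.rpow_le_rpow_of_exponent_le (one_le_two : (1 : ℝ) ≤ 2) hβ.le
    nlinarith
  have hfy := hbd _ hy hxy
  have hfy' := hbd _ hy' hxy'
  have hf0 := hf.nonneg _ hy
  have hf0' := hf.nonneg _ hy'
  have hanti := hf.anti hy hy' hyy
  have hsub := hf.sub_le hβ0 hy hy' hyy
  have hDu := leftBranchDeriv_eq (α := α) hy.1.le
  have hDu' := leftBranchDeriv_eq (α := α') hy'.1.le
  have hsum : Intermittent.transfer α f x - Intermittent.transfer α' f x =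
      (f (leftPreimage α x) - f (leftPreimage α' x)) / leftBranchDeriv α (leftPreimage α x) +
      f (leftPreimage α' x) * (leftBranchDeriv α' (leftPreimage α' x) -
        leftBranchDeriv α (leftPreimage α x)) / (leftBranchDeriv α (leftPreimage α x) *
          leftBranchDeriv α' (leftPreimage α' x)) := by
    have h1 : leftBranchDeriv α (leftPreimage α x) ≠ 0 := by linarith
    have h2 : leftBranchDeriv α' (leftPreimage α' x) ≠ 0 := by linarith
    simp only [Intermittent.transfer]
    field_simp
    ring
  rw [hsum]
  set y := leftPreimage α x
  set y' := leftPreimage α' x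
  set u := (2 * y) ^ α
  set u' := (2 * y') ^ α'
  set D := leftBranchDeriv α y
  set D' := leftBranchDeriv α' y'
  set B := 2 * A * x ^ (-β) with hB
  have hB0 : 0 ≤ B := hf0.trans hfy
  have huu : 0 ≤ u - u' := by
    by_contra! h
    have h1 : y * (1 + u) < y * (1 + u') := mul_lt_mul_of_pos_left (by linarith) hy.1
    have h2 : y * (1 + u') ≤ y' * (1 + u') := mul_le_mul_of_nonneg_right hyy (by linarith [hu'.1])
    linarith
  have hratio : 1 - y / y' ≤ u - u' := by
    have h1 : y / y' = (1 + u') / (1 + u) := by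
      rw [div_eq_div_iff hy'.1.ne' (by linarith [hu.1])]; linarith
    rw [h1, one_sub_div (by linarith [hu.1]), div_le_iff₀ (by linarith [hu.1])]
    nlinarith [hu.1]
  have hratio0 : 0 ≤ 1 - y / y' := by
    have := (div_le_one hy'.1).2 hyy
    linarith
  have t1 : |(f y - f y') / D| ≤ B * (2 * (u - u')) := by
    rw [abs_div, abs_of_nonneg (by linarith : 0 ≤ f y - f y'), abs_of_pos (by linarith : 0 < D)]
    refine (div_le_self (by linarith) hD1).trans (hsub.trans ?_)
    calc (1 + β) * (1 - y / y') * f y ≤ (2 * (u - u')) * B := by gcongr; linarith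
      _ = _ := mul_comm _ _
  have t2 : |f y' * (D' - D) / (D * D')| ≤ B * ((α' - α) + 2 * (u - u')) := by
    have hDD : 1 ≤ D * D' := one_le_mul_of_one_le_of_one_le hD1 hD1'
    rw [abs_div, abs_of_pos (by linarith : 0 < D * D'), abs_mul, abs_of_nonneg hf0']
    refine (div_le_self (by positivity) hDD).trans ?_
    refine mul_le_mul hfy' ?_ (abs_nonneg _) hB0
    rw [hDu, hDu', abs_le]
    constructor
    · nlinarith [hu.1, hu.2, hu'.1, hu'.2, mul_nonneg (sub_nonneg.2 hαα) hu'.1.le]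
    · nlinarith [hu.1, hu.2, hu'.1, hu'.2, mul_nonneg (sub_nonneg.2 hαα) hu'.1.le,
        mul_nonneg hα huu, mul_le_mul_of_nonneg_left hu'.2 (sub_nonneg.2 hαα)]
  have hxs : x ^ (-(β + s)) = x ^ (-β) * x ^ (-s) := by
    rw [neg_add, Real.rpow_add hx.1]
  have h1s : 1 ≤ x ^ (-s) := Real.one_le_rpow_of_pos_of_le_one_of_nonpos hx.1 hx.2 (by linarith)
  calc _ ≤ B * (2 * (u - u')) + B * ((α' - α) + 2 * (u - u')) := (abs_add_le _ _).trans
        (add_le_add t1 t2)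
    _ = B * ((α' - α) + 4 * (u - u')) := by ring
    _ ≤ B * ((α' - α) * x ^ (-s) + 4 * ((α' - α) * (x ^ (-s) / s))) := by
        refine mul_le_mul_of_nonneg_left (add_le_add ?_ (by linarith)) hB0
        exact le_mul_of_one_le_right (by linarith) h1s
    _ = _ := by rw [hxs, hB]; ring

theorem IsRegular.integral_abs_transfer_sub_transfer_le {α α' β A : ℝ} (hα : α ∈ Icc 0 β)
    (hα' : α' ∈ Icc 0 β) (hβ : β < 1) (hA : 0 ≤ A) {f : ℝ → ℝ} (hf : IsRegular β A f) :
    ∫ x, |Intermittent.transfer α f x - Intermittent.transfer α' f x| ∂leb ≤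
      4 * A * (1 + 8 / (1 - β)) / (1 - β) * |α - α'| := by
  wlog hαα : α ≤ α' generalizing α α'
  · rw [abs_sub_comm]
    simp only [abs_sub_comm (Intermittent.transfer α f _)]
    exact this hα' hα (le_of_not_ge hαα)
  -- Taking s = (1-β)/2 keeps the exponent β + s below 1, so the pointwise bound is integrable.
  have hs : 0 < (1 - β) / 2 := by linarith
  have hb : β + (1 - β) / 2 < 1 := by linarith
  have hβ' : 1 - β ≠ 0 := by linarith
  have hi := ((hf.toIsDecr.transfer hα.1).integrable.sub
    (hf.toIsDecr.transfer hα'.1).integrable).abs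
  have := integral_mono_ae hi ((integrable_rpow_leb hb).const_mul
    ((α' - α) * (2 * A * (1 + 4 / ((1 - β) / 2))))) (by
      filter_upwards [ae_leb_mem] with x hx
      exact hf.abs_transfer_sub_le hα.1 hαα hα'.2 hβ hA hs hx)
  refine this.trans_eq ?_
  rw [integral_const_mul, integral_rpow_leb hb, abs_sub_comm, abs_of_nonneg (by linarith)]
  have : 1 - (β + (1 - β) / 2) = (1 - β) / 2 := by ring
  rw [this]
  field_simp
  ring

/-! ### Lower bounds for iterated transfer operators -/

theorem iterate_leftPreimage_mem {α : ℝ} (hα : 0 ≤ α) (n : ℕ) {x : ℝ} (hx : x ∈ Ioc (0 : ℝ) 1) :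
    (leftPreimage α)^[n] x ∈ Ioc (0 : ℝ) 1 := by
  induction n with
  | zero => exact hx
  | succ n ih => rw [Function.iterate_succ_apply']; exact leftPreimage_mem hα ih

theorem IsDecr.iterate {α : ℝ} (hα : 0 ≤ α) {f : ℝ → ℝ} (hf : IsDecr f) (n : ℕ) :
    IsDecr ((Intermittent.transfer α)^[n] f) := by
  induction n with
  | zero => exact hf
  | succ n ih => rw [Function.iterate_succ_apply']; exact ih.transfer hα

theorem IsRegular.iterate {α β A : ℝ} (hα : α ∈ Icc 0 β) (hβ : β < 1) (hA : 2 ≤ A * (1 - β))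
    {f : ℝ → ℝ} (hf : IsRegular β A f) (n : ℕ) :
    IsRegular β A ((Intermittent.transfer α)^[n] f) := by
  induction n with
  | zero => exact hf
  | succ n ih => rw [Function.iterate_succ_apply']; exact ih.transfer hα hβ hA

theorem IsDecr.integral_iterate {α : ℝ} (hα : 0 ≤ α) {f : ℝ → ℝ} (hf : IsDecr f) (n : ℕ) :
    ∫ x, (Intermittent.transfer α)^[n] f x ∂leb = ∫ x, f x ∂leb := by
  induction n with
  | zero => rfl
  | succ n ih => rw [Function.iterate_succ_apply', (hf.iterate hα n).integral_transfer hα, ih]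

theorem iterate_transfer_sub (α : ℝ) (f g : ℝ → ℝ) (n : ℕ) :
    (transfer α)^[n] (fun x => f x - g x) =
      fun x => (transfer α)^[n] f x - (transfer α)^[n] g x := by
  induction n generalizing f g with
  | zero => rfl
  | succ n ih =>
    rw [Function.iterate_succ_apply', ih]
    funext x
    rw [transfer_sub, Function.iterate_succ_apply', Function.iterate_succ_apply']

theorem iterate_transfer_nonneg {α : ℝ} (hα : 0 ≤ α) {f : ℝ → ℝ}
    (hf : ∀ x ∈ Ioc (0 : ℝ) 1, 0 ≤ f x) (n : ℕ) :
    ∀ x ∈ Ioc (0 : ℝ) 1, 0 ≤ (transfer α)^[n] f x := by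
  induction n with
  | zero => exact hf
  | succ n ih => rw [Function.iterate_succ_apply']; exact fun x => transfer_nonneg hα ih

theorem antitone_integral_iterate_sub {α : ℝ} (hα : 0 ≤ α) {f g : ℝ → ℝ} (hf : IsDecr f)
    (hg : IsDecr g) :
    Antitone fun n : ℕ => ∫ x, |(transfer α)^[n] f x - (transfer α)^[n] g x| ∂leb := by
  refine antitone_nat_of_succ_le fun n => ?_
  simp only [Function.iterate_succ_apply']
  exact (hf.iterate hα n).integral_abs_transfer_sub_le hα (hg.iterate hα n)

/-- Along the left branch, distortion is controlled by `(1 + u) ^ 2`. -/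
theorem IsDecr.le_iterate {α : ℝ} (hα : α ∈ Icc (0 : ℝ) 1) {r : ℝ → ℝ} (hr : IsDecr r) (n : ℕ)
    {x : ℝ} (hx : x ∈ Ioc (0 : ℝ) 1) :
    r ((leftPreimage α)^[n] x) * ((leftPreimage α)^[n] x / x) ^ 2 ≤
      (Intermittent.transfer α)^[n] r x := by
  induction n generalizing x with
  | zero => simp [div_self hx.1.ne']
  | succ n ih =>
    have hy := leftPreimage_mem hα.1 hx
    have hu := two_mul_leftPreimage_rpow_mem hα.1 hx
    have hyx := leftPreimage_mul hα.1 hx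
    have hD := leftBranchDeriv_leftPreimage_pos hα.1 hx
    have hz := iterate_leftPreimage_mem hα.1 n hy
    have hDu := leftBranchDeriv_eq (α := α) hy.1.le
    rw [Function.iterate_succ_apply, Function.iterate_succ_apply']
    have h1 : (Intermittent.transfer α)^[n] r (leftPreimage α x) /
        leftBranchDeriv α (leftPreimage α x) ≤
        Intermittent.transfer α ((Intermittent.transfer α)^[n] r) x :=
      le_add_of_nonneg_right
        (div_nonneg ((hr.iterate hα.1 n).nonneg _ (rightPreimage_mem hx)) zero_le_two)
    refine le_trans ?_ h1
    rw [le_div_iff₀ (by linarith)]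
    refine le_trans ?_ (ih hy)
    set y := leftPreimage α x
    set z := (leftPreimage α)^[n] y
    have h2 : (z / x) ^ 2 * leftBranchDeriv α y ≤ (z / y) ^ 2 := by
      have h3 : z / y = z / x * (1 + (2 * y) ^ α) := by
        rw [div_mul_eq_mul_div, div_eq_div_iff hy.1.ne' hx.1.ne', mul_assoc,
          mul_comm (1 + (2 * y) ^ α), hyx]
      rw [h3, mul_pow, hDu]
      refine mul_le_mul_of_nonneg_left ?_ (sq_nonneg _)
      nlinarith [hu.1, hα.2]
    rw [mul_assoc]
    exact mul_le_mul_of_nonneg_left h2 (hr.nonneg _ hz)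

/-- Take the first left preimage of 1 at or below δ. From a point x > δ, one pullback decreases x by
y (2y)^α ≥ (δ/2)δ, which bounds the number of steps. It also at most halves x, so the first entry is
at least δ/2. -/
theorem exists_iterate_leftPreimage_mem {α δ : ℝ} (hα : α ∈ Icc (0 : ℝ) 1)
    (hδ : δ ∈ Ioo (0 : ℝ) 1) :
    ∃ n : ℕ, (n : ℝ) ≤ 3 / δ ^ 2 ∧ (leftPreimage α)^[n] 1 ∈ Icc (δ / 2) δ := by
  have h1mem : (1 : ℝ) ∈ Ioc (0 : ℝ) 1 := by norm_num
  have hmem := fun n => iterate_leftPreimage_mem hα.1 n h1mem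
  have hδ2 : 0 < δ ^ 2 := pow_pos hδ.1 2
  have hdec : ∀ n : ℕ, (∀ k < n, δ < (leftPreimage α)^[k] 1) →
      (leftPreimage α)^[n] 1 ≤ 1 - n * (δ ^ 2 / 2) := by
    intro n
    induction n with
    | zero => simp
    | succ n ih =>
      intro h
      have h1 := ih fun k hk => h k (hk.trans n.lt_succ_self)
      have h2 := h n n.lt_succ_self
      have h3 := half_le_leftPreimage hα.1 (hmem n)
      have h4 := leftPreimage_mul hα.1 (hmem n)
      have h5 := rpow_le_two_mul_leftPreimage_rpow hα.1 (hmem n) hα.2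
      rw [Real.rpow_one] at h5
      rw [Function.iterate_succ_apply']
      push_cast
      have h6 : δ / 2 ≤ leftPreimage α ((leftPreimage α)^[n] 1) := by linarith
      have h7 := h2.le.trans h5
      have h8 := mul_le_mul h7 h6 (by linarith [hδ.1]) (hδ.1.le.trans h7)
      linarith
  have hex : ∃ n, (leftPreimage α)^[n] 1 ≤ δ := by
    by_contra! h
    obtain ⟨n, hn⟩ := exists_nat_gt (1 / (δ ^ 2 / 2))
    have h1 := hdec n fun k _ => h k
    have h2 := (hmem n).1
    rw [div_lt_iff₀ (by positivity)] at hn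
    linarith
  classical
  have hspec := Nat.find_spec hex
  have hmin : ∀ k < Nat.find hex, δ < (leftPreimage α)^[k] 1 :=
    fun k hk => not_le.1 (Nat.find_min hex hk)
  obtain ⟨m, hm⟩ : ∃ m, Nat.find hex = m + 1 := by
    refine Nat.exists_eq_succ_of_ne_zero fun h0 => ?_
    rw [h0] at hspec
    exact absurd hspec (not_le.2 hδ.2)
  refine ⟨Nat.find hex, ?_, ?_, hspec⟩
  · have h1 := hdec m fun k hk => hmin k (by omega)
    have h2 := (hmem m).1
    rw [hm, le_div_iff₀ hδ2]
    push_cast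
    nlinarith [hδ.1, hδ.2]
  · have h1 := hmin m (by omega)
    rw [hm, Function.iterate_succ_apply']
    linarith [half_le_leftPreimage hα.1 (hmem m)]

/-- The mass on (δ,1] is at most r(δ), while the mass on (0,δ] is small because r ≤ A x^(-β) and
x^(-β) ≤ δ^s x^(-(β+s)) there. -/
theorem IsTame.le_apply {β A δ ε : ℝ} (hβ : β < 1) (hA : 0 ≤ A) (hδ : δ ∈ Ioc (0 : ℝ) 1)
    {r : ℝ → ℝ} (hr : IsTame β A r) (hε : ε ≤ ∫ x, r x ∂leb)
    (hδε : 2 * A * δ ^ ((1 - β) / 2) / (1 - β) ≤ ε / 2) : ε / 2 ≤ r δ := by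
  set s := (1 - β) / 2 with hs
  have hs0 : 0 < s := by rw [hs]; linarith
  have hb : β + s < 1 := by rw [hs]; linarith
  have h1 : ∫ x, r x ∂leb ≤ ∫ x, (r δ + A * δ ^ s * x ^ (-(β + s))) ∂leb := by
    refine integral_mono_ae hr.integrable
      ((integrable_const _).add ((integrable_rpow_leb hb).const_mul _)) ?_
    filter_upwards [ae_leb_mem] with x hx
    have hxp := Real.rpow_nonneg hx.1.le (-(β + s))
    have hδp := Real.rpow_nonneg hδ.1.le s
    rcases le_total x δ with hxδ | hxδ
    · have h2 : x ^ (-β) ≤ δ ^ s * x ^ (-(β + s)) := by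
        have h3 : x ^ (-β) = x ^ s * x ^ (-(β + s)) := by
          rw [← Real.rpow_add hx.1]; ring_nf
        rw [h3]
        exact mul_le_mul_of_nonneg_right (Real.rpow_le_rpow hx.1.le hxδ hs0.le) hxp
      have := hr.le_bound x hx
      have h4 := hr.nonneg δ hδ
      nlinarith
    · have := hr.anti hδ hx hxδ
      have : 0 ≤ A * δ ^ s * x ^ (-(β + s)) := by positivity
      linarith
  rw [integral_add (integrable_const _) ((integrable_rpow_leb hb).const_mul _), integral_const_mul,
    integral_rpow_leb hb] at h1
  rw [integral_const, probReal_univ, one_smul] at h1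
  have h2 : A * δ ^ s * (1 / (1 - (β + s))) = 2 * A * δ ^ s / (1 - β) := by
    have h3 : 1 - (β + s) = (1 - β) / 2 := by rw [hs]; ring
    have h4 : 1 - β ≠ 0 := by linarith
    rw [h3]
    field_simp
  linarith

/-- The iterate is decreasing, so its value at 1 is a lower bound. The all-left inverse branch alone
contributes at least r(z) z² there, with z in [δ/2, δ] and r(z) ≥ r(δ) ≥ ε/2. -/
theorem IsTame.le_iterate {α β A δ ε : ℝ} (hα : α ∈ Icc (0 : ℝ) 1) (hβ : β < 1) (hA : 0 ≤ A)
    (hδ : δ ∈ Ioc (0 : ℝ) 1) (hε0 : 0 ≤ ε)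
    {r : ℝ → ℝ} (hr : IsTame β A r) (hε : ε ≤ ∫ x, r x ∂leb)
    (hδε : 2 * A * δ ^ ((1 - β) / 2) / (1 - β) ≤ ε / 2) {n : ℕ}
    (hn : (leftPreimage α)^[n] 1 ∈ Icc (δ / 2) δ) {x : ℝ} (hx : x ∈ Ioc (0 : ℝ) 1) :
    ε * δ ^ 2 / 8 ≤ (Intermittent.transfer α)^[n] r x := by
  have h1mem : (1 : ℝ) ∈ Ioc (0 : ℝ) 1 := by norm_num
  have h1 := hr.toIsDecr.le_iterate hα n h1mem
  have h2 := (hr.toIsDecr.iterate hα.1 n).anti hx h1mem hx.2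
  have h3 := hr.anti (iterate_leftPreimage_mem hα.1 n h1mem) hδ hn.2
  have h4 := hr.le_apply hβ hA hδ hε hδε
  rw [div_one] at h1
  refine le_trans ?_ (h1.trans h2)
  calc ε * δ ^ 2 / 8 = ε / 2 * (δ / 2) ^ 2 := by ring
    _ ≤ _ := mul_le_mul (h4.trans h3) (pow_le_pow_left₀ (by linarith [hδ.1]) hn.1 2) (sq_nonneg _)
      ((by positivity : (0 : ℝ) ≤ ε / 2).trans (h4.trans h3))

/-! ### Coupling and polynomial loss of memory -/

section Coupling

variable {α β A ε κ : ℝ} {n : ℕ}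

/-- One coupling step: as long as the mass of a tame remainder is at least `ε`, the constant `κ`
may be subtracted from its image. -/
theorem exists_coupling (hα : α ∈ Icc 0 β) (hβ : β < 1) (hA : 2 ≤ A * (1 - β))
    (hn : ∀ r, IsTame β A r → ε ≤ ∫ x, r x ∂leb → ∀ x ∈ Ioc (0 : ℝ) 1, κ ≤ (transfer α)^[n] r x)
    (hκ : 0 ≤ κ) {f g : ℝ → ℝ} (hf : IsRegular β A f) (hg : IsRegular β A g) (j : ℕ) :
    ∃ u v : ℝ → ℝ, IsDecr u ∧ IsDecr v ∧
      (∀ x ∈ Ioc (0 : ℝ) 1, u x ≤ (transfer α)^[n * j] f x) ∧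
      (∀ x ∈ Ioc (0 : ℝ) 1, v x ≤ (transfer α)^[n * j] g x) ∧
      ∫ x, u x ∂leb = ∫ x, v x ∂leb ∧ ∫ x, u x ∂leb ≤ max ε (1 - j * κ) ∧
      ∀ x, (transfer α)^[n * j] f x - u x = (transfer α)^[n * j] g x - v x := by
  induction j with
  | zero =>
    exact ⟨f, g, hf.toIsDecr, hg.toIsDecr, fun _ _ => le_rfl, fun _ _ => le_rfl,
      hf.integral_eq.trans hg.integral_eq.symm, by simp [hf.integral_eq], fun x => by simp⟩
  | succ j ih =>
    obtain ⟨u, v, hu, hv, huf, hvg, huv, hle, heq⟩ := ih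
    have hiter : ∀ h : ℝ → ℝ, (transfer α)^[n * (j + 1)] h =
        (transfer α)^[n] ((transfer α)^[n * j] h) := fun h => by
      rw [← Function.iterate_add_apply, mul_add, mul_one, add_comm]
    have hdom : ∀ {w h : ℝ → ℝ}, (∀ x ∈ Ioc (0 : ℝ) 1, w x ≤ (transfer α)^[n * j] h x) →
        ∀ x ∈ Ioc (0 : ℝ) 1, (transfer α)^[n] w x ≤ (transfer α)^[n * (j + 1)] h x := by
      intro w h hw x hx
      have := iterate_transfer_nonneg hα.1 (fun x hx => sub_nonneg.2 (hw x hx)) n x hx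
      rw [iterate_transfer_sub] at this
      rw [hiter]
      linarith
    have heq' : ∀ x, (transfer α)^[n * (j + 1)] f x - (transfer α)^[n] u x =
        (transfer α)^[n * (j + 1)] g x - (transfer α)^[n] v x := by
      intro x
      have h1 := congrFun (iterate_transfer_sub α ((transfer α)^[n * j] f) u n) x
      have h2 := congrFun (iterate_transfer_sub α ((transfer α)^[n * j] g) v n) x
      rw [hiter, hiter, ← h1, ← h2, funext heq]
    have hu' := hu.iterate hα.1 n
    have hv' := hv.iterate hα.1 n
    have hiu := hu.integral_iterate hα.1 n
    have hiv := hv.integral_iterate hα.1 n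
    rcases le_total (∫ x, u x ∂leb) ε with h | h
    -- The mass is already at most ε: only push forward.
    · exact ⟨_, _, hu', hv', hdom huf, hdom hvg, by rw [hiu, hiv, huv],
        by rw [hiu]; exact h.trans (le_max_left _ _), heq'⟩
    -- Subtracting constants may destroy the monotonicity of x^(β+1) u, but domination by a regular
    -- iterate keeps u tame, which is all that `hn` requires.
    · have htu : IsTame β A u := ⟨hu, fun x hx => (huf x hx).trans
        ((hf.iterate hα hβ hA _).le_bound x hx)⟩
      have htv : IsTame β A v := ⟨hv, fun x hx => (hvg x hx).trans
        ((hg.iterate hα hβ hA _).le_bound x hx)⟩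
      have hsub : ∀ {w : ℝ → ℝ}, IsDecr w → (∀ x ∈ Ioc (0 : ℝ) 1, κ ≤ w x) →
          IsDecr fun x => w x - κ := fun hw hκw =>
        ⟨fun x hx => sub_nonneg.2 (hκw x hx),
          fun x hx y hy hxy => sub_le_sub_right (hw.anti hx hy hxy) _,
          hw.integrable.sub (integrable_const _)⟩
      have hint : ∀ {w : ℝ → ℝ}, IsDecr w → ∫ x, (w x - κ) ∂leb = ∫ x, w x ∂leb - κ :=
        fun hw => by
          rw [integral_sub hw.integrable (integrable_const _)]
          simp
      refine ⟨_, _, hsub hu' (hn u htu h), hsub hv' (hn v htv (huv ▸ h)),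
        fun x hx => (sub_le_self _ hκ).trans (hdom huf x hx),
        fun x hx => (sub_le_self _ hκ).trans (hdom hvg x hx), ?_, ?_, fun x => ?_⟩
      · rw [hint hu', hint hv', hiu, hiv, huv]
      · rw [hint hu', hiu]
        push_cast
        rcases le_max_iff.1 hle with h' | h'
        · exact le_max_of_le_left (by linarith)
        · exact le_max_of_le_right (by linarith)
      · have := heq' x
        linarith

theorem integral_iterate_sub_le (hα : α ∈ Icc 0 β) (hβ : β < 1) (hA : 2 ≤ A * (1 - β))
    (hn : ∀ r, IsTame β A r → ε ≤ ∫ x, r x ∂leb → ∀ x ∈ Ioc (0 : ℝ) 1, κ ≤ (transfer α)^[n] r x)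
    (hκ : 0 ≤ κ) {f g : ℝ → ℝ} (hf : IsRegular β A f) (hg : IsRegular β A g) (j : ℕ) :
    ∫ x, |(transfer α)^[n * j] f x - (transfer α)^[n * j] g x| ∂leb ≤
      2 * max ε (1 - j * κ) := by
  obtain ⟨u, v, hu, hv, -, -, huv, hle, heq⟩ := exists_coupling hα hβ hA hn hκ hf hg j
  have h1 : ∫ x, |(transfer α)^[n * j] f x - (transfer α)^[n * j] g x| ∂leb ≤
      ∫ x, (u x + v x) ∂leb := by
    refine integral_mono_ae ((hf.toIsDecr.iterate hα.1 _).integrable.sub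
      (hg.toIsDecr.iterate hα.1 _).integrable).abs (hu.integrable.add hv.integrable) ?_
    filter_upwards [ae_leb_mem] with x hx
    have h2 := heq x
    have h3 := hu.nonneg x hx
    have h4 := hv.nonneg x hx
    rw [abs_le]
    constructor <;> linarith
  rw [integral_add hu.integrable hv.integrable] at h1
  linarith

end Coupling

/-- Uniform polynomial loss of memory on regular densities. -/
theorem exists_decay {β A : ℝ} (hβ : β ∈ Ioo (0 : ℝ) 1) (hA : 2 ≤ A * (1 - β)) :
    ∃ p ∈ Ioo (0 : ℝ) 1, ∃ K > 0, ∀ α ∈ Icc 0 β, ∀ f g : ℝ → ℝ, IsRegular β A f →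
      IsRegular β A g → ∀ N : ℕ, 1 ≤ N →
        ∫ x, |(transfer α)^[N] f x - (transfer α)^[N] g x| ∂leb ≤ K * (N : ℝ) ^ (-p) := by
  have h1β : 0 < 1 - β := by linarith [hβ.2]
  have hA0 : 2 ≤ A := by nlinarith [hβ.1]
  -- Below, δ^s = cε makes the mass condition of `IsTame.le_iterate` an equality. Each coupling
  -- takes at most 3/δ² steps and removes κ = εδ²/8, and at most 2/κ couplings are made, so the time
  -- is at most 48/(εδ⁴) = C ε^(-P). Setting this equal to N defines ε.
  set s := (1 - β) / 2 with hs
  have hs0 : 0 < s := by rw [hs]; linarith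
  set c := (1 - β) / (4 * A) with hc
  have hc0 : 0 < c := by positivity
  have hc1 : c < 1 := by rw [hc, div_lt_one (by linarith)]; linarith [hβ.1]
  set P := 1 + 4 / s with hP
  have hP1 : 1 < P := by rw [hP]; have : 0 < 4 / s := by positivity
                         linarith
  set C := 48 / c ^ (4 / s) with hC
  have hC0 : 0 < C := by positivity
  refine ⟨1 / P, ⟨by positivity, (div_lt_one (by linarith)).2 hP1⟩, 2 * C ^ (1 / P),
    by positivity, fun α hα f g hf hg N hN => ?_⟩
  have hN0 : (0 : ℝ) < N := by exact_mod_cast hN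
  set ε := (C / N) ^ (1 / P) with hε
  have hε0 : 0 < ε := by positivity
  have hKε : 2 * C ^ (1 / P) * (N : ℝ) ^ (-(1 / P)) = 2 * ε := by
    rw [hε, Real.div_rpow hC0.le hN0.le, Real.rpow_neg hN0.le, mul_assoc, div_eq_mul_inv (C ^ _)]
  rw [hKε]
  have hα1 : α ∈ Icc (0 : ℝ) 1 := ⟨hα.1, hα.2.trans hβ.2.le⟩
  have hanti := antitone_integral_iterate_sub hα.1 hf.toIsDecr hg.toIsDecr
  rcases le_or_gt ε 1 with hε1 | hε1
  · set δ := (c * ε) ^ (1 / s) with hδ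
    have hcε : c * ε < 1 := by nlinarith
    have hδmem : δ ∈ Ioo (0 : ℝ) 1 :=
      ⟨by positivity, Real.rpow_lt_one (by positivity) hcε (by positivity)⟩
    have hδs : δ ^ s = c * ε := by
      rw [hδ, ← Real.rpow_mul (by positivity), one_div_mul_cancel hs0.ne', Real.rpow_one]
    have hδε : 2 * A * δ ^ ((1 - β) / 2) / (1 - β) ≤ ε / 2 := by
      rw [← hs, hδs, hc]
      refine le_of_eq ?_
      field_simp
      ring
    obtain ⟨n, hn, hnmem⟩ := exists_iterate_leftPreimage_mem hα1 hδmem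
    set κ := ε * δ ^ 2 / 8 with hκ
    have hδ0 := hδmem.1
    have hκ0 : 0 < κ := by positivity
    have hκ1 : κ ≤ 1 := by
      have : δ ^ 2 ≤ 1 := pow_le_one₀ hδ0.le hδmem.2.le
      rw [hκ]; nlinarith
    have hb := integral_iterate_sub_le hα hβ.2 hA (ε := ε) (κ := κ) (n := n)
      (fun r hr hεr x hx => hr.le_iterate hα1 hβ.2 (by linarith) (Ioo_subset_Ioc_self hδmem)
        hε0.le hεr hδε hnmem hx) hκ0.le hf hg ⌈1 / κ⌉₊
    have hJ : 1 ≤ (⌈1 / κ⌉₊ : ℝ) * κ := by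
      have := Nat.le_ceil (1 / κ)
      rwa [div_le_iff₀ hκ0] at this
    rw [max_eq_left (by linarith)] at hb
    refine le_trans (hanti ?_) hb
    have hJ2 : (⌈1 / κ⌉₊ : ℝ) ≤ 2 / κ := by
      have h1 := (Nat.ceil_lt_add_one (by positivity : 0 ≤ 1 / κ)).le
      have h2 : 1 ≤ 1 / κ := (one_le_div hκ0).2 hκ1
      calc (⌈1 / κ⌉₊ : ℝ) ≤ 1 / κ + 1 / κ := by linarith
        _ = 2 / κ := by ring
    have hNeq : C / ε ^ P = N := by
      rw [hε, ← Real.rpow_mul (by positivity), one_div_mul_cancel (by linarith), Real.rpow_one]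
      field_simp
    have hδ4 : δ ^ 4 = c ^ (4 / s) * ε ^ (4 / s) := by
      rw [← Real.mul_rpow hc0.le hε0.le, hδ, ← Real.rpow_natCast, ← Real.rpow_mul (by positivity)]
      congr 1
      push_cast
      ring
    have hfin : ((n * ⌈1 / κ⌉₊ : ℕ) : ℝ) ≤ N := by
      push_cast
      calc (n : ℝ) * ⌈1 / κ⌉₊ ≤ (3 / δ ^ 2) * (2 / κ) := by gcongr
        _ = 48 / (ε * δ ^ 4) := by rw [hκ]; field_simp; ring
        _ = C / ε ^ P := by
            rw [hδ4, hP, Real.rpow_add hε0, Real.rpow_one, hC]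
            field_simp
        _ = N := hNeq
    exact_mod_cast hfin
  -- For ε > 1 the trivial bound 2 on the distance suffices; it is the coupling estimate with no
  -- step made.
  · have h0 := integral_iterate_sub_le (n := 0) (ε := 1) (κ := 0) hα hβ.2 hA
      (fun r hr _ x hx => hr.nonneg x hx) le_rfl hf hg 0
    refine (hanti (Nat.zero_le N)).trans ?_
    simp only [mul_zero, sub_zero, max_self] at h0
    linarith

/-! ### The invariant density -/

open Filter Topology

/-- Completeness of L¹, phrased with honest functions. -/
theorem exists_tendsto_integral_abs_sub {Ω : Type*} [MeasurableSpace Ω] {μ : Measure Ω}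
    {v : ℕ → Ω → ℝ} (hv : ∀ n, Integrable (v n) μ) {b : ℕ → ℝ} (hb : Tendsto b atTop (𝓝 0))
    (h : ∀ n m N, N ≤ n → N ≤ m → ∫ x, |v n x - v m x| ∂μ ≤ b N) :
    ∃ w : Ω → ℝ, Integrable w μ ∧ Tendsto (fun n => ∫ x, |v n x - w x| ∂μ) atTop (𝓝 0) := by
  have hdist : ∀ n (w : Ω →₁[μ] ℝ), dist ((hv n).toL1 (v n)) w = ∫ x, |v n x - w x| ∂μ := by
    intro n w
    rw [L1.dist_eq_integral_dist]
    refine integral_congr_ae ?_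
    filter_upwards [(hv n).coeFn_toL1] with x hx
    rw [hx, Real.dist_eq]
  have hc : CauchySeq fun n => (hv n).toL1 (v n) := by
    refine cauchySeq_of_le_tendsto_0 b (fun n m N hn hm => ?_) hb
    rw [hdist]
    refine le_trans (le_of_eq (integral_congr_ae ?_)) (h n m N hn hm)
    filter_upwards [(hv m).coeFn_toL1] with x hx
    rw [hx]
  obtain ⟨w, hw⟩ := cauchySeq_tendsto_of_complete hc
  refine ⟨w, L1.integrable_coeFn w, ?_⟩
  have := tendsto_iff_dist_tendsto_zero.1 hw
  simpa only [hdist] using this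

theorem abs_setIntegral_sub_le {Ω : Type*} [MeasurableSpace Ω] {μ : Measure Ω} {f g : Ω → ℝ}
    (hf : Integrable f μ) (hg : Integrable g μ) (s : Set Ω) :
    |∫ x in s, f x ∂μ - ∫ x in s, g x ∂μ| ≤ ∫ x, |f x - g x| ∂μ := by
  rw [← integral_sub hf.integrableOn hg.integrableOn]
  exact (abs_integral_le_integral_abs).trans (setIntegral_le_integral (hf.sub hg).abs
    (ae_of_all _ fun x => abs_nonneg _))

theorem real_withDensity_ofReal {Ω : Type*} [MeasurableSpace Ω] {μ : Measure Ω} {f : Ω → ℝ}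
    (hf : Integrable f μ) (h0 : 0 ≤ᵐ[μ] f) {s : Set Ω} (hs : MeasurableSet s) :
    (μ.withDensity fun x => ENNReal.ofReal (f x)).real s = ∫ x in s, f x ∂μ := by
  rw [measureReal_def, withDensity_apply _ hs, ← ofReal_integral_eq_lintegral_ofReal
    hf.integrableOn (ae_restrict_of_ae h0), ENNReal.toReal_ofReal]
  exact integral_nonneg_of_ae (ae_restrict_of_ae h0)

theorem isFiniteMeasure_withDensity_ofReal' {Ω : Type*} [MeasurableSpace Ω] {μ : Measure Ω}
    {f : Ω → ℝ} (hf : Integrable f μ) :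
    IsFiniteMeasure (μ.withDensity fun x => ENNReal.ofReal (f x)) :=
  isFiniteMeasure_withDensity_ofReal hf.2

theorem IsDecr.ae_nonneg {f : ℝ → ℝ} (hf : IsDecr f) : 0 ≤ᵐ[leb] f := by
  filter_upwards [ae_leb_mem] with x hx using hf.nonneg x hx

theorem measurable_evolve (a : ℕ → ℝ) (k : ℕ) : Measurable (evolve a k) := by
  induction k with
  | zero => exact measurable_id
  | succ k ih => exact (measurable_pmMap _).comp ih

theorem IsDecr.pushDensity {a : ℕ → ℝ} {k : ℕ} (ha : ∀ j, j + 1 ≤ k → 0 ≤ a (j + 1)) {f : ℝ → ℝ}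
    (hf : IsDecr f) : IsDecr (pushDensity a f k) := by
  induction k with
  | zero => exact hf
  | succ k ih => exact (ih fun j hj => ha j (by omega)).transfer (ha k le_rfl)

theorem IsRegular.pushDensity {β A : ℝ} {a : ℕ → ℝ} {k : ℕ}
    (ha : ∀ j, j + 1 ≤ k → a (j + 1) ∈ Icc 0 β)
    (hβ : β < 1) (hA : 2 ≤ A * (1 - β)) {f : ℝ → ℝ}
    (hf : IsRegular β A f) : IsRegular β A (pushDensity a f k) := by
  induction k with
  | zero => exact hf
  | succ k ih => exact (ih fun j hj => ha j (by omega)).transfer (ha k le_rfl) hβ hA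

theorem map_evolve_withDensity {a : ℕ → ℝ} {k : ℕ} (ha : ∀ j, j + 1 ≤ k → 0 ≤ a (j + 1))
    {f : ℝ → ℝ} (hf : IsDecr f) :
    (leb.withDensity fun x => ENNReal.ofReal (f x)).map (evolve a k) =
      leb.withDensity fun x => ENNReal.ofReal (pushDensity a f k x) := by
  induction k with
  | zero => exact Measure.map_id
  | succ k ih =>
    have ha' : ∀ j, j + 1 ≤ k → 0 ≤ a (j + 1) := fun j hj => ha j (by omega)
    have hk := hf.pushDensity ha'
    rw [evolve, ← Measure.map_map (measurable_pmMap _) (measurable_evolve a k), ih ha',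
      map_pmMap_withDensity (ha k le_rfl) hk.nonneg hk.integrable.aemeasurable]
    rfl

theorem evolve_const (α : ℝ) (k : ℕ) : evolve (fun _ => α) k = (pmMap α)^[k] := by
  induction k with
  | zero => rfl
  | succ k ih => rw [evolve, ih, Function.iterate_succ']

theorem pushDensity_const (α : ℝ) (h : ℝ → ℝ) (k : ℕ) :
    pushDensity (fun _ => α) h k = (transfer α)^[k] h := by
  induction k with
  | zero => rfl
  | succ k ih => rw [pushDensity, ih, Function.iterate_succ_apply']

theorem IsDecr.setIntegral_preimage_iterate {α : ℝ} (hα : 0 ≤ α) {f : ℝ → ℝ} (hf : IsDecr f)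
    (n : ℕ) {s : Set ℝ} (hs : MeasurableSet s) :
    ∫ x in (pmMap α)^[n] ⁻¹' s, f x ∂leb = ∫ x in s, (Intermittent.transfer α)^[n] f x ∂leb := by
  have hT := (measurable_pmMap α).iterate n
  have h := map_evolve_withDensity (a := fun _ => α) (k := n) (fun _ _ => hα) hf
  rw [evolve_const, pushDensity_const] at h
  rw [← real_withDensity_ofReal hf.integrable hf.ae_nonneg (hT hs),
    ← real_withDensity_ofReal (hf.iterate hα n).integrable (hf.iterate hα n).ae_nonneg hs, ← h,
    measureReal_def, measureReal_def, Measure.map_apply hT hs]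

theorem exists_rpow_eq {c s : ℝ} (hc : c ∈ Ioo (0 : ℝ) 1) (hs : 0 < s) :
    ∃ δ ∈ Ioo (0 : ℝ) 1, δ ^ s = c :=
  ⟨c ^ (1 / s), ⟨Real.rpow_pos_of_pos hc.1 _, Real.rpow_lt_one hc.1.le hc.2 (by positivity)⟩, by
    rw [← Real.rpow_mul hc.1.le, one_div_mul_cancel hs.ne', Real.rpow_one]⟩

theorem exists_lower_bound {α β A : ℝ} (hα : α ∈ Icc 0 β) (hβ : β < 1) (hA : 2 ≤ A * (1 - β)) :
    ∃ n : ℕ, ∃ κ > 0, ∀ r, IsRegular β A r → ∀ x ∈ Ioc (0 : ℝ) 1, κ ≤ (transfer α)^[n] r x := by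
  have hβ0 := hα.1.trans hα.2
  have hA0 : 2 ≤ A := by nlinarith
  have h1β : 0 < 1 - β := by linarith
  obtain ⟨δ, hδ, hδs⟩ := exists_rpow_eq (c := (1 - β) / (4 * A)) (s := (1 - β) / 2)
    ⟨by positivity, by rw [div_lt_one (by linarith)]; linarith⟩ (by linarith)
  have hα1 : α ∈ Icc (0 : ℝ) 1 := ⟨hα.1, hα.2.trans hβ.le⟩
  obtain ⟨n, -, hn⟩ := exists_iterate_leftPreimage_mem hα1 hδ
  have := hδ.1
  refine ⟨n, 1 * δ ^ 2 / 8, by positivity, fun r hr x hx => hr.toIsTame.le_iterate hα1 hβ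
    (by linarith) (Ioo_subset_Ioc_self hδ) zero_le_one hr.integral_eq.ge ?_ hn hx⟩
  rw [hδs]
  refine le_of_eq ?_
  field_simp
  ring

/-- For n ≥ N the iterate L^n 1 is L^N applied to the regular density L^(n-N) 1. Loss of memory
therefore makes the sequence Cauchy, and comparing L^N f with it and letting n → ∞ gives the rate
for every regular f. -/
theorem exists_invariant_density {α β A p K : ℝ} (hα : α ∈ Icc 0 β) (hβ : β < 1)
    (hA : 2 ≤ A * (1 - β)) (hp : 0 < p)
    (hdecay : ∀ f g : ℝ → ℝ, IsRegular β A f → IsRegular β A g → ∀ N : ℕ, 1 ≤ N →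
      ∫ x, |(transfer α)^[N] f x - (transfer α)^[N] g x| ∂leb ≤ K * (N : ℝ) ^ (-p)) :
    ∃ w : ℝ → ℝ, Integrable w leb ∧ (∃ κ > 0, ∀ x, κ ≤ w x) ∧
      ∀ f, IsRegular β A f → ∀ N : ℕ, 1 ≤ N →
        ∫ x, |(transfer α)^[N] f x - w x| ∂leb ≤ K * (N : ℝ) ^ (-p) := by
  have hβ0 := hα.1.trans hα.2
  have h1 : IsRegular β A fun _ => 1 := isRegular_one hβ0 (by nlinarith)
  set v : ℕ → ℝ → ℝ := fun n => (transfer α)^[n] fun _ => 1 with hvdef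
  have hv : ∀ n, IsRegular β A (v n) := fun n => h1.iterate hα hβ hA n
  -- The shift by one keeps the exponent at least 1, where the decay hypothesis applies.
  have hb : Tendsto (fun N : ℕ => K * ((N + 1 : ℕ) : ℝ) ^ (-p)) atTop (𝓝 0) := by
    have h2 := ((tendsto_rpow_neg_atTop hp).comp tendsto_natCast_atTop_atTop).const_mul K
    rw [mul_zero] at h2
    exact h2.comp (tendsto_add_atTop_nat 1)
  obtain ⟨w, hw, hlim⟩ := exists_tendsto_integral_abs_sub (v := fun n => v (n + 1)) (μ := leb)
    (fun n => (hv (n + 1)).integrable) hb (by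
      intro n m N hn hm
      have hsplit : ∀ k, N ≤ k → v (k + 1) = (transfer α)^[N + 1] (v (k - N)) := fun k hk => by
        rw [hvdef]
        simp only
        rw [← Function.iterate_add_apply]
        congr 1
        omega
      rw [hsplit n hn, hsplit m hm]
      exact hdecay _ _ (hv _) (hv _) (N + 1) (by omega))
  obtain ⟨n₀, κ, hκ, hlow⟩ := exists_lower_bound hα hβ hA
  -- The iterates are eventually at least κ, so truncating the limit from below does not increase
  -- its distance to them; this gives a representative positive everywhere.
  have hwi : Integrable (fun x => max (w x) κ) leb := hw.sup (integrable_const κ)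
  have hlim' : Tendsto (fun n => ∫ x, |v (n + 1) x - max (w x) κ| ∂leb) atTop (𝓝 0) := by
    refine squeeze_zero' (Eventually.of_forall fun n => integral_nonneg fun x => abs_nonneg _) ?_
      hlim
    filter_upwards [eventually_ge_atTop n₀] with n hn
    refine integral_mono_ae ((hv _).integrable.sub hwi).abs ((hv _).integrable.sub hw).abs ?_
    filter_upwards [ae_leb_mem] with x hx
    have h2 : κ ≤ v (n + 1) x := by
      have : v (n + 1) = (transfer α)^[n₀] (v (n + 1 - n₀)) := by
        rw [hvdef]
        simp only
        rw [← Function.iterate_add_apply]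
        congr 1
        omega
      rw [this]
      exact hlow _ (hv _) x hx
    rcases le_total (w x) κ with h3 | h3
    · rw [max_eq_right h3, abs_of_nonneg (by linarith)]
      exact le_trans (by linarith) (le_abs_self _)
    · rw [max_eq_left h3]
  refine ⟨fun x => max (w x) κ, hwi, ⟨κ, hκ, fun x => le_max_right _ _⟩, fun f hf N hN => ?_⟩
  refine ge_of_tendsto (x := atTop) (f := fun n => K * (N : ℝ) ^ (-p) +
    ∫ x, |v (n + 1) x - max (w x) κ| ∂leb) (by simpa using hlim'.const_add (K * (N : ℝ) ^ (-p))) ?_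
  filter_upwards [eventually_ge_atTop N] with n hn
  have hsplit : v (n + 1) = (transfer α)^[N] (v (n + 1 - N)) := by
    rw [hvdef]
    simp only
    rw [← Function.iterate_add_apply]
    congr 1
    omega
  have h2 := hdecay f _ hf (hv (n + 1 - N)) N hN
  rw [← hsplit] at h2
  have hi1 : Integrable (fun x => |(transfer α)^[N] f x - v (n + 1) x|) leb :=
    ((hf.iterate hα hβ hA N).integrable.sub (hv (n + 1)).integrable).abs
  have hi2 : Integrable (fun x => |v (n + 1) x - max (w x) κ|) leb :=
    ((hv (n + 1)).integrable.sub hwi).abs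
  refine le_trans ?_ (add_le_add_left h2 _)
  rw [← integral_add hi1 hi2]
  exact integral_mono ((hf.iterate hα hβ hA N).integrable.sub hwi).abs (hi1.add hi2)
    fun x => abs_sub_le _ _ _

/-! ### Existence and uniqueness of the SRB measure -/

section SRB

variable {α β A p K : ℝ} {w : ℝ → ℝ}

theorem tendsto_rpow_bound (hp : 0 < p) :
    Tendsto (fun n : ℕ => K * (n : ℝ) ^ (-p)) atTop (𝓝 0) := by
  simpa using ((tendsto_rpow_neg_atTop hp).comp tendsto_natCast_atTop_atTop).const_mul K

theorem tendsto_setIntegral_iterate (hα : α ∈ Icc 0 β) (hβ : β < 1) (hA : 2 ≤ A * (1 - β))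
    (hp : 0 < p) (hw : Integrable w leb)
    (hlim : ∀ f, IsRegular β A f → ∀ N : ℕ, 1 ≤ N →
      ∫ x, |(transfer α)^[N] f x - w x| ∂leb ≤ K * (N : ℝ) ^ (-p))
    {f : ℝ → ℝ} (hf : IsRegular β A f) (s : Set ℝ) :
    Tendsto (fun n : ℕ => ∫ x in s, (transfer α)^[n] f x ∂leb) atTop
      (𝓝 (∫ x in s, w x ∂leb)) := by
  rw [tendsto_iff_dist_tendsto_zero]
  refine squeeze_zero' (Eventually.of_forall fun _ => dist_nonneg) ?_
    (tendsto_rpow_bound (K := K) hp)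
  filter_upwards [eventually_ge_atTop 1] with n hn
  exact (abs_setIntegral_sub_le (hf.iterate hα hβ hA n).integrable hw s).trans (hlim f hf n hn)

/-- Invariance passes to the limit: the integral of L^n 1 over the preimage of s equals that of
L^(n+1) 1 over s. The lower bound κ gives equivalence with Lebesgue measure. -/
theorem isSRBMeasure_withDensity (hα : α ∈ Icc 0 β) (hβ : β < 1) (hA : 2 ≤ A * (1 - β))
    (hp : 0 < p) (hw : Integrable w leb) (hpos : ∃ κ > 0, ∀ x, κ ≤ w x)
    (hlim : ∀ f, IsRegular β A f → ∀ N : ℕ, 1 ≤ N →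
      ∫ x, |(transfer α)^[N] f x - w x| ∂leb ≤ K * (N : ℝ) ^ (-p)) :
    IsSRBMeasure α (leb.withDensity fun x => ENNReal.ofReal (w x)) := by
  obtain ⟨κ, hκ, hκw⟩ := hpos
  have hβ0 := hα.1.trans hα.2
  have h1 : IsRegular β A fun _ => 1 := isRegular_one hβ0 (by nlinarith)
  have hconv := fun s => tendsto_setIntegral_iterate hα hβ hA hp hw hlim h1 s
  have hw0 : 0 ≤ᵐ[leb] w := ae_of_all _ fun x => hκ.le.trans (hκw x)
  have hfin := isFiniteMeasure_withDensity_ofReal' hw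
  refine ⟨⟨?_⟩, ⟨measurable_pmMap α, ?_⟩, withDensity_absolutelyContinuous _ _,
    withDensity_absolutelyContinuous' hw.aemeasurable.ennreal_ofReal
      (ae_of_all _ fun x => (ENNReal.ofReal_pos.2 (hκ.trans_le (hκw x))).ne')⟩
  · have h2 := hconv univ
    simp only [Measure.restrict_univ, (h1.iterate hα hβ hA _).integral_eq] at h2
    have h3 := real_withDensity_ofReal hw hw0 MeasurableSet.univ
    rw [Measure.restrict_univ, tendsto_nhds_unique h2 tendsto_const_nhds, measureReal_def] at h3
    exact (ENNReal.toReal_eq_one_iff _).1 h3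
  · ext s hs
    rw [Measure.map_apply (measurable_pmMap α) hs, ← ENNReal.toReal_eq_toReal_iff'
      (measure_ne_top _ _) (measure_ne_top _ _), ← measureReal_def, ← measureReal_def,
      real_withDensity_ofReal hw hw0 (measurable_pmMap α hs), real_withDensity_ofReal hw hw0 hs]
    refine tendsto_nhds_unique (hconv _) ?_
    refine ((hconv s).comp (tendsto_add_atTop_nat 1)).congr fun n => ?_
    have h2 := (h1.toIsDecr.iterate hα.1 n).setIntegral_preimage_iterate hα.1 1 hs
    simp only [Function.iterate_one] at h2
    rw [h2, Function.comp_apply, Function.iterate_succ_apply']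

/-- A Lipschitz function with values between `D` and `2 * D`, decreasing on `(0,1]`, is regular
after normalisation. -/
theorem isRegular_of_lipschitz {D M : ℝ} (hβ : 0 ≤ β) (hA : 2 ≤ A) (hD0 : 0 < D) (hM : M ≤ D)
    {F : ℝ → ℝ} (hanti : AntitoneOn F (Ioc 0 1)) (hD : ∀ x ∈ Ioc (0 : ℝ) 1, D ≤ F x)
    (hD2 : ∀ x ∈ Ioc (0 : ℝ) 1, F x ≤ 2 * D)
    (hL : ∀ x ∈ Ioc (0 : ℝ) 1, ∀ y ∈ Ioc (0 : ℝ) 1, x ≤ y → F x - F y ≤ M * (y - x)) :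
    Integrable F leb ∧ 0 < ∫ x, F x ∂leb ∧ IsRegular β A fun x => F x / ∫ x, F x ∂leb := by
  have hi : Integrable F leb := by
    refine (integrable_const (2 * D)).mono'
      (aemeasurable_of_antitoneOn hanti).aestronglyMeasurable ?_
    filter_upwards [ae_leb_mem] with x hx
    rw [Real.norm_eq_abs, abs_of_nonneg (hD0.le.trans (hD x hx))]
    exact hD2 x hx
  have hDI : D ≤ ∫ x, F x ∂leb := by
    have := integral_mono_ae (integrable_const D) hi (by
      filter_upwards [ae_leb_mem] with x hx using hD x hx)
    simpa using this
  set I := ∫ x, F x ∂leb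
  have hI : 0 < I := hD0.trans_le hDI
  refine ⟨hi, hI, ⟨⟨fun x hx => div_nonneg (hD0.le.trans (hD x hx)) hI.le,
    fun x hx y hy hxy => div_le_div_of_nonneg_right (hanti hx hy hxy) hI.le, hi.div_const _⟩,
    fun x hx => ?_⟩, fun x hx y hy hxy => ?_, ?_⟩
  · have h1 := Real.one_le_rpow_of_pos_of_le_one_of_nonpos hx.1 hx.2 (neg_nonpos.2 hβ)
    rw [div_le_iff₀ hI]
    calc F x ≤ 2 * 1 * D := by linarith [hD2 x hx]
      _ ≤ A * x ^ (-β) * I := by gcongr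
  · simp only
    rw [← mul_div_assoc, ← mul_div_assoc]
    refine div_le_div_of_nonneg_right ?_ hI.le
    have hq : 0 ≤ y / x - 1 := by rw [sub_nonneg, one_le_div hx.1]; exact hxy
    have h1 := one_add_mul_self_le_rpow_one_add (s := y / x - 1) (p := β + 1) (by linarith)
      (by linarith)
    rw [add_sub_cancel] at h1
    have h2 : y ^ (β + 1) = x ^ (β + 1) * (y / x) ^ (β + 1) := by
      rw [← Real.mul_rpow hx.1.le (div_nonneg hy.1.le hx.1.le), mul_div_cancel₀ _ hx.1.ne']
    -- The factor gained, 1 + (y - x), compensates the loss F x - F y ≤ M (y - x), because F y ≥ D ≥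
    -- M.
    have h3 : 1 + (y - x) ≤ (y / x) ^ (β + 1) := by
      refine le_trans ?_ h1
      have h4 : y - x = (y / x - 1) * x := by field_simp [hx.1.ne']
      rw [h4]
      nlinarith [hx.2, mul_nonneg hβ hq]
    rw [h2, mul_assoc]
    refine mul_le_mul_of_nonneg_left ?_ (Real.rpow_nonneg hx.1.le _)
    have h5 := hL x hx y hy hxy
    have h6 := hD y hy
    have h7 := mul_le_mul_of_nonneg_right h3 (hD0.le.trans h6)
    nlinarith [mul_le_mul_of_nonneg_left (hM.trans h6) (sub_nonneg.2 hxy)]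
  · rw [integral_div, div_self hI.ne']

/-- Compactly supported continuous functions are dense in L¹, and Weierstrass replaces them by
polynomials, which are Lipschitz on [0,1]. -/
theorem exists_lipschitz_near {g : ℝ → ℝ} (hg : Integrable g leb) {ε : ℝ} (hε : 0 < ε) :
    ∃ (q : ℝ → ℝ) (M : ℝ), Continuous q ∧ 0 ≤ M ∧ (∀ x ∈ Icc (0 : ℝ) 1, |q x| ≤ M) ∧
      (∀ x ∈ Icc (0 : ℝ) 1, ∀ y ∈ Icc (0 : ℝ) 1, |q y - q x| ≤ M * |y - x|) ∧
      ∫ x, |g x - q x| ∂leb ≤ ε := by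
  have : (leb : Measure ℝ).Regular := by unfold leb; infer_instance
  obtain ⟨k, -, hk, hkc, hki⟩ := hg.exists_hasCompactSupport_integral_sub_le (half_pos hε)
  obtain ⟨q, hq⟩ := exists_polynomial_near_of_continuousOn 0 1 k hkc.continuousOn _ (half_pos hε)
  obtain ⟨M₁, hM₁⟩ := isCompact_Icc.exists_bound_of_continuousOn (s := Icc (0 : ℝ) 1)
    q.continuous.continuousOn
  obtain ⟨M₂, hM₂⟩ := isCompact_Icc.exists_bound_of_continuousOn (s := Icc (0 : ℝ) 1)
    (Polynomial.derivative q).continuous.continuousOn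
  have h0 : (0 : ℝ) ∈ Icc (0 : ℝ) 1 := by norm_num
  have hM0 : 0 ≤ M₁ := (norm_nonneg _).trans (hM₁ 0 h0)
  refine ⟨fun x => q.eval x, max M₁ M₂, q.continuous, hM0.trans (le_max_left _ _),
    fun x hx => (hM₁ x hx).trans (le_max_left _ _), fun x hx y hy => ?_, ?_⟩
  · exact (convex_Icc 0 1).norm_image_sub_le_of_norm_hasDerivWithin_le
      (fun x _ => (q.hasDerivAt x).hasDerivWithinAt)
      (fun x hx => (hM₂ x hx).trans (le_max_right _ _)) hx hy
  · have hqi : Integrable (fun x => q.eval x) leb :=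
      (q.continuous.continuousOn.integrableOn_Icc : IntegrableOn _ (Icc (0 : ℝ) 1) volume)
    have hi1 : Integrable (fun x => |g x - k x|) leb := (hg.sub hki).abs
    have h1 : ∫ x, |g x - q.eval x| ∂leb ≤ ∫ x, (|g x - k x| + ε / 2) ∂leb := by
      refine integral_mono_ae (hg.sub hqi).abs (hi1.add (integrable_const _)) ?_
      filter_upwards [ae_leb_mem] with x hx
      have h2 := hq x (Ioc_subset_Icc_self hx)
      rw [abs_sub_comm] at h2
      exact (abs_sub_le _ (k x) _).trans (add_le_add_right h2.le _)
    rw [integral_add hi1 (integrable_const _)] at h1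
    simp only [Real.norm_eq_abs] at hk
    simp only [integral_const, probReal_univ, one_smul] at h1
    linarith

/-- Adding M(1 - x) to an M-Lipschitz q makes it decreasing, and a large constant makes it regular
up to scaling. The added function is itself such a multiple, so q is a difference of two. -/
theorem exists_regular_difference_near (hβ : 0 ≤ β) (hA : 2 ≤ A) {g : ℝ → ℝ}
    (hg : Integrable g leb) {ε : ℝ} (hε : 0 < ε) :
    ∃ (f₁ f₂ : ℝ → ℝ) (m₁ m₂ : ℝ), IsRegular β A f₁ ∧ IsRegular β A f₂ ∧
      ∫ x, |g x - (m₁ * f₁ x - m₂ * f₂ x)| ∂leb ≤ ε := by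
  obtain ⟨q, M, -, hM, hqM, hqL, hq⟩ := exists_lipschitz_near hg hε
  have hL : ∀ x ∈ Ioc (0 : ℝ) 1, ∀ y ∈ Ioc (0 : ℝ) 1, x ≤ y → |q y - q x| ≤ M * (y - x) :=
    fun x hx y hy hxy => by
      have := hqL x (Ioc_subset_Icc_self hx) y (Ioc_subset_Icc_self hy)
      rwa [abs_of_nonneg (sub_nonneg.2 hxy)] at this
  have hB : ∀ x ∈ Ioc (0 : ℝ) 1, -M ≤ q x ∧ q x ≤ M :=
    fun x hx => abs_le.1 (hqM x (Ioc_subset_Icc_self hx))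
  -- As |q| ≤ M, the sum lies between 3M + 1 = D and 6M + 1 ≤ 2D, with slopes at most 2M ≤ D.
  obtain ⟨-, hI1, h1⟩ := isRegular_of_lipschitz (β := β) (A := A) (D := 3 * M + 1) (M := 2 * M)
    (F := fun x => q x + M * (1 - x) + (4 * M + 1)) hβ hA (by linarith) (by linarith)
    (fun x hx y hy hxy => by have := abs_le.1 (hL x hx y hy hxy); simp only; nlinarith)
    (fun x hx => by have := hB x hx; nlinarith [hx.2, mul_nonneg hM (sub_nonneg.2 hx.2)])
    (fun x hx => by have := hB x hx; nlinarith [mul_nonneg hM hx.1.le])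
    (fun x hx y hy hxy => by have := abs_le.1 (hL x hx y hy hxy); nlinarith)
  obtain ⟨-, hI2, h2⟩ := isRegular_of_lipschitz (β := β) (A := A) (D := 3 * M + 1) (M := 2 * M)
    (F := fun x => M * (1 - x) + (4 * M + 1)) hβ hA (by linarith) (by linarith)
    (fun x hx y hy hxy => by simp only; nlinarith)
    (fun x hx => by nlinarith [hx.2, mul_nonneg hM (sub_nonneg.2 hx.2)])
    (fun x hx => by nlinarith [mul_nonneg hM hx.1.le])
    (fun x hx y hy hxy => by nlinarith [mul_nonneg hM (sub_nonneg.2 hxy)])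
  refine ⟨_, _, ∫ x, (q x + M * (1 - x) + (4 * M + 1)) ∂leb, ∫ x, (M * (1 - x) + (4 * M + 1)) ∂leb,
    h1, h2, le_of_eq_of_le ?_ hq⟩
  refine integral_congr_ae (ae_of_all _ fun x => ?_)
  simp only
  rw [mul_div_cancel₀ _ hI1.ne', mul_div_cancel₀ _ hI2.ne']
  congr 1
  ring

/-- Approximate the density of ν by m₁ f₁ - m₂ f₂ with regular f₁, f₂. Invariance gives ν(s) =
ν(T^(-n) s), which is within ε/2 of m₁ ∫_s L^n f₁ - m₂ ∫_s L^n f₂. The latter tends to (m₁ - m₂) ∫_s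
w, and m₁ - m₂ is within ε/2 of 1. -/
theorem IsSRBMeasure.eq_withDensity (hα : α ∈ Icc 0 β) (hβ : β < 1) (hA : 2 ≤ A * (1 - β))
    (hp : 0 < p) (hw : Integrable w leb) (hpos : ∃ κ > 0, ∀ x, κ ≤ w x)
    (hlim : ∀ f, IsRegular β A f → ∀ N : ℕ, 1 ≤ N →
      ∫ x, |(transfer α)^[N] f x - w x| ∂leb ≤ K * (N : ℝ) ^ (-p))
    {ν : Measure ℝ} (hν : IsSRBMeasure α ν) :
    ν = leb.withDensity fun x => ENNReal.ofReal (w x) := by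
  have hβ0 := hα.1.trans hα.2
  have hνp := hν.isProbabilityMeasure
  have hsrb := isSRBMeasure_withDensity hα hβ hA hp hw hpos hlim
  obtain ⟨κ, hκ, hκw⟩ := hpos
  have hw0 : 0 ≤ᵐ[leb] w := ae_of_all _ fun x => hκ.le.trans (hκw x)
  have hwfin := hsrb.isProbabilityMeasure
  have hw1 : ∫ x, w x ∂leb = 1 := by
    have := real_withDensity_ofReal hw hw0 MeasurableSet.univ
    rwa [Measure.restrict_univ, probReal_univ, eq_comm] at this
  set g : ℝ → ℝ := fun x => (ν.rnDeriv leb x).toReal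
  have hg : Integrable g leb := Measure.integrable_toReal_rnDeriv
  have hνg : ∀ s : Set ℝ, ν.real s = ∫ x in s, g x ∂leb := fun s =>
    (Measure.setIntegral_toReal_rnDeriv hν.absolutelyContinuous s).symm
  ext s hs
  rw [← ENNReal.toReal_eq_toReal_iff' (measure_ne_top _ _) (measure_ne_top _ _),
    ← measureReal_def, ← measureReal_def, real_withDensity_ofReal hw hw0 hs]
  refine eq_of_abs_sub_le_all fun ε hε => ?_
  obtain ⟨f₁, f₂, m₁, m₂, h1, h2, hε2⟩ :=
    exists_regular_difference_near hβ0 (by nlinarith : 2 ≤ A) hg (half_pos hε)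
  have hi1 := h1.integrable.const_mul m₁
  have hi2 := h2.integrable.const_mul m₂
  have hmass : |1 - (m₁ - m₂)| ≤ ε / 2 := by
    have := abs_setIntegral_sub_le hg (hi1.sub hi2) univ
    rw [← hνg, probReal_univ, Measure.restrict_univ] at this
    simp only [Pi.sub_apply] at this
    rw [integral_sub hi1 hi2, integral_const_mul, integral_const_mul, h1.integral_eq,
      h2.integral_eq, mul_one, mul_one] at this
    exact this.trans hε2
  have hn : ∀ n : ℕ, |ν.real s - (m₁ * ∫ x in s, (transfer α)^[n] f₁ x ∂leb -
      m₂ * ∫ x in s, (transfer α)^[n] f₂ x ∂leb)| ≤ ε / 2 := by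
    intro n
    have hT := hν.invariant.iterate n
    have := abs_setIntegral_sub_le hg (hi1.sub hi2) ((pmMap α)^[n] ⁻¹' s)
    rw [← hνg, measureReal_def, hT.measure_preimage hs.nullMeasurableSet, ← measureReal_def] at this
    simp only [Pi.sub_apply] at this
    rw [integral_sub hi1.integrableOn hi2.integrableOn, integral_const_mul, integral_const_mul,
      h1.toIsDecr.setIntegral_preimage_iterate hα.1 n hs,
      h2.toIsDecr.setIntegral_preimage_iterate hα.1 n hs] at this
    exact this.trans hε2
  have hl := (((tendsto_setIntegral_iterate hα hβ hA hp hw hlim h1 s).const_mul m₁).sub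
    ((tendsto_setIntegral_iterate hα hβ hA hp hw hlim h2 s).const_mul m₂)).const_sub (ν.real s)
  have hfin := le_of_tendsto hl.abs (Eventually.of_forall hn)
  have hws0 : 0 ≤ ∫ x in s, w x ∂leb := integral_nonneg fun x => hκ.le.trans (hκw x)
  have hws1 : ∫ x in s, w x ∂leb ≤ 1 := hw1 ▸ setIntegral_le_integral hw hw0
  rw [abs_le] at hmass hfin ⊢
  constructor <;> nlinarith

end SRB

theorem exists_srbMeasure_eq {β A : ℝ} (hβ : β ∈ Ioo (0 : ℝ) 1) (hA : 2 ≤ A * (1 - β)) :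
    ∃ p ∈ Ioo (0 : ℝ) 1, ∃ K > 0, ∀ α ∈ Icc 0 β, ∃ w : ℝ → ℝ, Integrable w leb ∧ (∀ x, 0 ≤ w x) ∧
      srbMeasure α = leb.withDensity (fun x => ENNReal.ofReal (w x)) ∧
      ∀ f, IsRegular β A f → ∀ N : ℕ, 1 ≤ N →
        ∫ x, |(transfer α)^[N] f x - w x| ∂leb ≤ K * (N : ℝ) ^ (-p) := by
  obtain ⟨p, hp, K, hK, hdecay⟩ := exists_decay hβ hA
  refine ⟨p, hp, K, hK, fun α hα => ?_⟩
  obtain ⟨w, hw, hpos, hlim⟩ := exists_invariant_density hα hβ.2 hA hp.1 (hdecay α hα)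
  have hsrb := isSRBMeasure_withDensity hα hβ.2 hA hp.1 hw hpos hlim
  have hex : ∃ μ, IsSRBMeasure α μ := ⟨_, hsrb⟩
  refine ⟨w, hw, ?_, ?_, hlim⟩
  · obtain ⟨κ, hκ, h⟩ := hpos
    exact fun x => hκ.le.trans (h x)
  · rw [srbMeasure, dif_pos hex]
    exact hex.choose_spec.eq_withDensity hα hβ.2 hA hp.1 hw hpos hlim

theorem srbDensity_ae_eq {α : ℝ} {w : ℝ → ℝ} (hw : Integrable w leb) (hw0 : ∀ x, 0 ≤ w x)
    (h : srbMeasure α = leb.withDensity fun x => ENNReal.ofReal (w x)) :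
    srbDensity α =ᵐ[leb] w := by
  filter_upwards [h ▸ Measure.rnDeriv_withDensity₀ leb hw.aemeasurable.ennreal_ofReal] with x hx
  rw [srbDensity, hx, ENNReal.toReal_ofReal (hw0 x)]

/-! ### Comparison with a frozen parameter -/

section Approximation

variable {β A : ℝ} {a : ℕ → ℝ} {h : ℝ → ℝ}

/-- Replacing the last `N` nonautonomous steps by steps of a fixed nearby transfer operator. -/
theorem integral_abs_pushDensity_sub_iterate_le (hβ : β < 1) (hA : 2 ≤ A * (1 - β)) {α d : ℝ}
    (hα : α ∈ Icc 0 β) {m : ℕ} (N : ℕ) (ha : ∀ j, j + 1 ≤ m + N → a (j + 1) ∈ Icc 0 β)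
    (hd : ∀ j, m ≤ j → j + 1 ≤ m + N → |a (j + 1) - α| ≤ d) (hh : IsRegular β A h) :
    ∫ x, |pushDensity a h (m + N) x - (transfer α)^[N] (pushDensity a h m) x| ∂leb ≤
      N * (4 * A * (1 + 8 / (1 - β)) / (1 - β) * d) := by
  have h1β : 0 < 1 - β := by linarith
  have hA0 : 0 ≤ A := by by_contra! hneg; nlinarith
  induction N with
  | zero => simp
  | succ N ih =>
    have ha' : ∀ j, j + 1 ≤ m + N → a (j + 1) ∈ Icc 0 β := fun j hj => ha j (by omega)
    have ih := ih ha' fun j h1 h2 => hd j h1 (by omega)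
    have hm : IsRegular β A (pushDensity a h m) :=
      hh.pushDensity (fun j hj => ha j (by omega)) hβ hA
    have hmN : IsRegular β A (pushDensity a h (m + N)) := hh.pushDensity ha' hβ hA
    have haN : a (m + N + 1) ∈ Icc 0 β := ha (m + N) (by omega)
    have hit := hm.iterate hα hβ hA N
    have hdN := hd (m + N) (by omega) (by omega)
    -- One new step adds the error of changing the parameter, while the L¹ contraction keeps the
    -- earlier error from growing.
    have h1 := hmN.integral_abs_transfer_sub_transfer_le haN hα hβ hA0
    have h2 := hmN.toIsDecr.integral_abs_transfer_sub_le hα.1 hit.toIsDecr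
    have hi0 := hmN.toIsDecr.transfer haN.1
    have hi1 := hmN.toIsDecr.transfer hα.1
    have hi2 := hit.toIsDecr.transfer hα.1
    have hi3 : Integrable (fun x => |transfer (a (m + N + 1)) (pushDensity a h (m + N)) x -
        transfer α (pushDensity a h (m + N)) x|) leb := (hi0.integrable.sub hi1.integrable).abs
    have hi4 : Integrable (fun x => |transfer α (pushDensity a h (m + N)) x -
        transfer α ((transfer α)^[N] (pushDensity a h m)) x|) leb :=
      (hi1.integrable.sub hi2.integrable).abs
    have h3 : ∫ x, |pushDensity a h (m + (N + 1)) x -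
        (transfer α)^[N + 1] (pushDensity a h m) x| ∂leb ≤
        ∫ x, (|transfer (a (m + N + 1)) (pushDensity a h (m + N)) x -
          transfer α (pushDensity a h (m + N)) x| + |transfer α (pushDensity a h (m + N)) x -
          transfer α ((transfer α)^[N] (pushDensity a h m)) x|) ∂leb := by
      rw [Function.iterate_succ_apply']
      exact integral_mono (hi0.integrable.sub hi2.integrable).abs (hi3.add hi4)
        fun x => abs_sub_le _ _ _
    rw [integral_add hi3 hi4] at h3
    have h4 : 4 * A * (1 + 8 / (1 - β)) / (1 - β) * |a (m + N + 1) - α| ≤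
        4 * A * (1 + 8 / (1 - β)) / (1 - β) * d := mul_le_mul_of_nonneg_left hdN (by positivity)
    push_cast
    linarith

end Approximation

/-- The window n^(θ/4) balances the errors: θ/4 + (θ/4 - 1)θ ≤ -θ/2 ≤ -pθ/4. The floor costs at most
a factor 2, as n^(θ/4) ≥ 1. -/
theorem rpow_bound {θ p C K₁ K : ℝ} (hθ : θ ∈ Ioc (0 : ℝ) 1) (hp : p ∈ Ioo (0 : ℝ) 1)
    (hC : 0 < C) (hK₁ : 0 ≤ K₁) (hK : 0 < K) {n : ℕ} (hn : 1 ≤ n) :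
    (⌊(n : ℝ) ^ (θ / 4)⌋₊ : ℝ) * (K₁ * (3 * C * (n : ℝ) ^ ((θ / 4 - 1) * θ))) +
      K * (⌊(n : ℝ) ^ (θ / 4)⌋₊ : ℝ) ^ (-p) ≤
      (3 * C * K₁ + 2 * K) * (n : ℝ) ^ (-(p * θ / 4)) := by
  have hn1 : (1 : ℝ) ≤ n := by exact_mod_cast hn
  have hn0 : (0 : ℝ) < n := by linarith
  have hx1 : 1 ≤ (n : ℝ) ^ (θ / 4) := Real.one_le_rpow hn1 (by linarith [hθ.1])
  have hx0 : 0 < (n : ℝ) ^ (θ / 4) := by linarith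
  have hfl : (n : ℝ) ^ (θ / 4) / 2 ≤ ⌊(n : ℝ) ^ (θ / 4)⌋₊ := by
    have h1 := Nat.lt_floor_add_one ((n : ℝ) ^ (θ / 4))
    have h2 : (1 : ℝ) ≤ ⌊(n : ℝ) ^ (θ / 4)⌋₊ := by exact_mod_cast Nat.one_le_floor_iff _ |>.2 hx1
    linarith
  have t1 : (⌊(n : ℝ) ^ (θ / 4)⌋₊ : ℝ) * (n : ℝ) ^ ((θ / 4 - 1) * θ) ≤
      (n : ℝ) ^ (-(p * θ / 4)) := by
    calc _ ≤ (n : ℝ) ^ (θ / 4) * (n : ℝ) ^ ((θ / 4 - 1) * θ) := by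
          gcongr
          exact Nat.floor_le hx0.le
      _ = (n : ℝ) ^ (θ / 4 + (θ / 4 - 1) * θ) := (Real.rpow_add hn0 _ _).symm
      _ ≤ _ := by
          refine Real.rpow_le_rpow_of_exponent_le hn1 ?_
          nlinarith [hθ.1, hθ.2, hp.2, mul_nonneg hθ.1.le (sub_nonneg.2 hθ.2),
            mul_nonneg hθ.1.le (sub_nonneg.2 hp.2.le)]
  have t2 : (⌊(n : ℝ) ^ (θ / 4)⌋₊ : ℝ) ^ (-p) ≤ 2 * (n : ℝ) ^ (-(p * θ / 4)) := by
    calc _ ≤ ((n : ℝ) ^ (θ / 4) / 2) ^ (-p) :=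
          Real.rpow_le_rpow_of_nonpos (by positivity) hfl (by linarith [hp.1])
      _ = 2 ^ p * (n : ℝ) ^ (-(p * θ / 4)) := by
          rw [Real.div_rpow hx0.le zero_le_two, Real.rpow_neg zero_le_two, div_inv_eq_mul,
            ← Real.rpow_mul hn0.le, mul_comm]
          ring_nf
      _ ≤ _ := by
          refine mul_le_mul_of_nonneg_right ?_ (by positivity)
          simpa using Real.rpow_le_rpow_of_exponent_le (one_le_two : (1 : ℝ) ≤ 2) hp.2.le
  have h1 := mul_le_mul_of_nonneg_left t1 (by positivity : 0 ≤ 3 * C * K₁)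
  have h2 := mul_le_mul_of_nonneg_left t2 hK.le
  linarith

/-! ### Parameters of the array inside one Hölder interval -/

section QDS

variable {β θ C : ℝ} {α : ℕ → ℕ → ℝ} {γ : ℝ → ℝ} {r : ℕ} {τ : Fin (r + 1) → ℝ}

theorem IsIntermittentQDS.partition_nonneg (hQ : IsIntermittentQDS β θ C α γ τ)
    (i : Fin (r + 1)) : 0 ≤ τ i :=
  hQ.partition_zero ▸ hQ.partition_strictMono.monotone (Fin.zero_le i)

theorem IsIntermittentQDS.partition_le_one (hQ : IsIntermittentQDS β θ C α γ τ)
    (i : Fin (r + 1)) : τ i ≤ 1 :=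
  hQ.partition_last ▸ hQ.partition_strictMono.monotone (Fin.le_last i)

theorem IsIntermittentQDS.abs_sub_curve_le (hQ : IsIntermittentQDS β θ C α γ τ) {n : ℕ}
    (hn : 1 ≤ n) {k : ℕ} (hk : k ≤ n) : |α n k - γ (k / n)| ≤ C * (n : ℝ) ^ (-θ) := by
  have hn0 : (0 : ℝ) < n := by exact_mod_cast hn
  have h := hQ.approx n hn (k / n) ⟨by positivity, (div_le_one hn0).2 (by exact_mod_cast hk)⟩
  rwa [mul_div_cancel₀ _ hn0.ne', Nat.floor_natCast] at h

/-- Every j in the window satisfies j > nτ_ℓ, so j/n and t lie in one Hölder interval, at distance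
at most n^(q-1). The Hölder error and the array error each contribute one C. -/
theorem IsIntermittentQDS.abs_sub_curve_le_of_near (hQ : IsIntermittentQDS β θ C α γ τ)
    (hθ : 0 < θ) (hC : 0 < C) {q : ℝ} (hq : 0 ≤ q) {n : ℕ} (hn : 1 ≤ n) (l : Fin r) {t : ℝ}
    (ht : t ∈ Ioo (τ l.castSucc) (τ l.succ)) {k j : ℕ} (hkt : (k : ℝ) ≤ n * t)
    (htk : n * t < k + 1) (hk : n * τ l.castSucc + (n : ℝ) ^ q < k) (hjk : j ≤ k)
    (hj : k < j + ⌊(n : ℝ) ^ q⌋₊) :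
    |α n j - γ t| ≤ 2 * C * (n : ℝ) ^ ((q - 1) * θ) := by
  have hn1 : (1 : ℝ) ≤ n := by exact_mod_cast hn
  have hn0 : (0 : ℝ) < n := by linarith
  have hfl : (⌊(n : ℝ) ^ q⌋₊ : ℝ) ≤ (n : ℝ) ^ q := Nat.floor_le (by positivity)
  have hjk' : (j : ℝ) ≤ k := by exact_mod_cast hjk
  have hj' : (k : ℝ) + 1 ≤ j + ⌊(n : ℝ) ^ q⌋₊ := by exact_mod_cast hj
  have hjt : (j : ℝ) / n ≤ t := by rw [div_le_iff₀ hn0]; linarith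
  have hjn : j ≤ n := by
    have : (j : ℝ) ≤ n := by
      have := ht.2.le.trans (hQ.partition_le_one l.succ)
      nlinarith
    exact_mod_cast this
  have hjmem : (j : ℝ) / n ∈ Ioo (τ l.castSucc) (τ l.succ) := by
    refine ⟨?_, hjt.trans_lt ht.2⟩
    rw [lt_div_iff₀ hn0]
    linarith
  have h1 := hQ.abs_sub_curve_le hn hjn
  have h2 := hQ.holder l t ht (j / n) hjmem
  have h3 : |(j : ℝ) / n - t| ^ θ ≤ (n : ℝ) ^ ((q - 1) * θ) := by
    rw [Real.rpow_mul hn0.le]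
    refine Real.rpow_le_rpow (abs_nonneg _) ?_ hθ.le
    rw [abs_sub_comm, abs_of_nonneg (sub_nonneg.2 hjt), Real.rpow_sub_one hn0.ne', le_div_iff₀ hn0,
      sub_mul, div_mul_cancel₀ _ hn0.ne']
    linarith
  have h4 : (n : ℝ) ^ (-θ) ≤ (n : ℝ) ^ ((q - 1) * θ) :=
    Real.rpow_le_rpow_of_exponent_le hn1 (by nlinarith)
  have h5 := abs_sub_le (α n j) (γ (j / n)) (γ t)
  have h6 := mul_le_mul_of_nonneg_left h3 hC.le
  have h7 := mul_le_mul_of_nonneg_left h4 hC.le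
  linarith

end QDS

/-! ### Expectations of bounded observables and the final estimate -/

theorem integral_withDensity_ofReal {Ω : Type*} [MeasurableSpace Ω] {μ : Measure Ω} {g : Ω → ℝ}
    (hg : AEMeasurable g μ) (h0 : 0 ≤ᵐ[μ] g) (f : Ω → ℝ) :
    ∫ x, f x ∂(μ.withDensity fun x => ENNReal.ofReal (g x)) = ∫ x, g x * f x ∂μ := by
  rw [integral_withDensity_eq_integral_toReal_smul₀ hg.ennreal_ofReal
    (ae_of_all _ fun _ => ENNReal.ofReal_lt_top)]
  refine integral_congr_ae ?_
  filter_upwards [h0] with x hx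
  rw [ENNReal.toReal_ofReal hx, smul_eq_mul]

theorem abs_integral_withDensity_sub_le {Ω : Type*} [MeasurableSpace Ω] {μ : Measure Ω}
    {g g' f : Ω → ℝ} (hg : Integrable g μ) (h0 : 0 ≤ᵐ[μ] g) (hg' : Integrable g' μ)
    (h0' : 0 ≤ᵐ[μ] g') (hf : MemLp f ⊤ μ) :
    |∫ x, f x ∂(μ.withDensity fun x => ENNReal.ofReal (g x)) -
      ∫ x, f x ∂(μ.withDensity fun x => ENNReal.ofReal (g' x))| ≤
      (eLpNorm f ⊤ μ).toReal * ∫ x, |g x - g' x| ∂μ := by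
  have hb : ∀ᵐ x ∂μ, ‖f x‖ ≤ (eLpNorm f ⊤ μ).toReal := by
    filter_upwards [ae_le_eLpNormEssSup (f := f) (μ := μ)] with x hx
    rw [← toReal_enorm]
    exact ENNReal.toReal_mono hf.2.ne (by rwa [eLpNorm_exponent_top])
  have hi := hg.mul_bdd hf.1 hb
  have hi' := hg'.mul_bdd hf.1 hb
  rw [integral_withDensity_ofReal hg.aemeasurable h0,
    integral_withDensity_ofReal hg'.aemeasurable h0',
    ← integral_sub hi hi', ← integral_const_mul]
  refine abs_integral_le_integral_abs.trans
    (integral_mono_ae (hi.sub hi').abs ((hg.sub hg').abs.const_mul _) ?_)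
  filter_upwards [hb] with x hx
  rw [← sub_mul, abs_mul, mul_comm]
  exact mul_le_mul_of_nonneg_right hx (abs_nonneg _)

end Intermittent

theorem lemma7 (β θ : ℝ) (hβ : β ∈ Ioo (0 : ℝ) 1) (hθ : θ ∈ Ioc (0 : ℝ) 1) :
    ∃ p₀ ∈ Ioo (0 : ℝ) 1, ∃ p₁ ∈ Ioo (0 : ℝ) 1, ∃ c₁ : ℝ, 0 < c₁ ∧
      ∀ C : ℝ, 0 < C → ∃ c₀ : ℝ, 0 < c₀ ∧
        ∀ (α : ℕ → ℕ → ℝ) (γ : ℝ → ℝ) (r : ℕ) (τ : Fin (r + 1) → ℝ),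
          IsIntermittentQDS β θ C α γ τ →
        ∀ (h : ℝ → ℝ) (μ : Measure ℝ), InCone β h → IsProbabilityMeasure μ →
          μ = leb.withDensity (fun x => ENNReal.ofReal (h x)) →
        ∀ n : ℕ, 1 ≤ n →
          (∀ k : ℕ, k ≤ n →
            μ.map (evolve (α n) k) =
              leb.withDensity (fun x => ENNReal.ofReal (pushDensity (α n) h k x))) ∧
          (∀ (l : Fin r) (k : ℕ),
            (n : ℝ) * (τ l.castSucc + c₁ * (n : ℝ) ^ (p₁ - 1)) < k → (k : ℝ) < n * τ l.succ →
            eLpNorm (fun x => pushDensity (α n) h k x - srbDensity (α n k) x) 1 leb ≤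
              ENNReal.ofReal (c₀ * (n : ℝ) ^ (-p₀))) ∧
          (∀ f : ℝ → ℝ, MemLp f ⊤ leb → ∀ (l : Fin r) (t : ℝ),
            τ l.castSucc + c₁ * (n : ℝ) ^ (p₁ - 1) < t → t < τ l.succ →
            |(∫ x, f (evolve (α n) ⌊(n : ℝ) * t⌋₊ x) ∂μ) - ∫ x, f x ∂(srbMeasure (γ t))| ≤
              c₀ * (eLpNorm f ⊤ leb).toReal * (n : ℝ) ^ (-p₀)) := by
  -- Large enough both for A(1-β) ≥ 2 and for A ≥ 6 ≥ 2^β (β + 2), the constant of the cone.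
  set A := 6 / (1 - β) with hAdef
  have h1β : 0 < 1 - β := by linarith [hβ.2]
  have hA1 : A * (1 - β) = 6 := div_mul_cancel₀ _ h1β.ne'
  have hA : 2 ≤ A * (1 - β) := by linarith
  have hA6 : 6 ≤ A := by rw [hAdef, le_div_iff₀ h1β]; linarith [hβ.1]
  obtain ⟨p, hp, K, hK, hsrb⟩ := exists_srbMeasure_eq hβ hA
  have hθ0 := hθ.1
  have hp0 := hp.1
  set K₁ := 4 * A * (1 + 8 / (1 - β)) / (1 - β) with hK₁def
  have hK₁ : 0 ≤ K₁ := by positivity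
  -- In c₁ = 2, one n^(θ/4) holds the window and the other covers the rounding of nt, as n^(θ/4) ≥
  -- 1.
  refine ⟨p * θ / 4, ⟨by positivity, by nlinarith [hθ.2, hp.2]⟩, θ / 4,
    ⟨by positivity, by linarith [hθ.2]⟩, 2, two_pos, fun C hC => ⟨3 * C * K₁ + 2 * K, by positivity,
    fun α γ r τ hQ h μ hcone hμp hμ n hn => ?_⟩⟩
  have hn1 : (1 : ℝ) ≤ n := by exact_mod_cast hn
  have hn0 : (0 : ℝ) < n := by linarith
  have hh0 : 0 ≤ᵐ[leb] h := by filter_upwards [ae_leb_mem] with x hx using hcone.nonneg x hx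
  have hh : Intermittent.IsRegular β A h := hcone.isRegular hβ hA6 (by
    have h1 := real_withDensity_ofReal hcone.integrable hh0 MeasurableSet.univ
    rw [← hμ, Measure.restrict_univ, probReal_univ] at h1
    exact h1.symm)
  have hmem : ∀ k ≤ n, ∀ j, j + 1 ≤ k → α n (j + 1) ∈ Icc 0 β :=
    fun k hk j hj => hQ.array_mem n (j + 1) hn (hj.trans hk)
  have hmap : ∀ k : ℕ, k ≤ n → μ.map (evolve (α n) k) =
      leb.withDensity (fun x => ENNReal.ofReal (pushDensity (α n) h k x)) := fun k hk => by
    rw [hμ]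
    exact map_evolve_withDensity (fun j hj => (hmem k hk j hj).1) hh.toIsDecr
  have hreg : ∀ k ≤ n, Intermittent.IsRegular β A (pushDensity (α n) h k) :=
    fun k hk => hh.pushDensity (hmem k hk) hβ.2 hA
  have hx1 : 1 ≤ (n : ℝ) ^ (θ / 4) := Real.one_le_rpow hn1 (by linarith)
  have hN1 : 1 ≤ ⌊(n : ℝ) ^ (θ / 4)⌋₊ := (Nat.one_le_floor_iff _).2 hx1
  have hfl : (⌊(n : ℝ) ^ (θ / 4)⌋₊ : ℝ) ≤ (n : ℝ) ^ (θ / 4) := Nat.floor_le (by positivity)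
  have hsplit : ∀ T : ℝ, (n : ℝ) * (T + 2 * (n : ℝ) ^ (θ / 4 - 1)) =
      n * T + 2 * (n : ℝ) ^ (θ / 4) := fun T => by
    rw [Real.rpow_sub_one hn0.ne']
    field_simp
  -- the distance to the invariant density of any parameter close to the last ones of the array
  have main : ∀ (k : ℕ) (a : ℝ) (w : ℝ → ℝ), k ≤ n → (n : ℝ) ^ (θ / 4) < k → a ∈ Icc 0 β →
      Integrable w leb → (∀ f, Intermittent.IsRegular β A f → ∀ N : ℕ, 1 ≤ N →
        ∫ x, |(transfer a)^[N] f x - w x| ∂leb ≤ K * (N : ℝ) ^ (-p)) →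
      (∀ j, j ≤ k → k < j + ⌊(n : ℝ) ^ (θ / 4)⌋₊ →
        |α n j - a| ≤ 3 * C * (n : ℝ) ^ ((θ / 4 - 1) * θ)) →
      ∫ x, |pushDensity (α n) h k x - w x| ∂leb ≤
        (3 * C * K₁ + 2 * K) * (n : ℝ) ^ (-(p * θ / 4)) := by
    intro k a w hk hNk ha hw hlim hclose
    have hNk' : ⌊(n : ℝ) ^ (θ / 4)⌋₊ ≤ k := by exact_mod_cast hfl.trans hNk.le
    obtain ⟨m, rfl⟩ := Nat.exists_eq_add_of_le' hNk'
    set N := ⌊(n : ℝ) ^ (θ / 4)⌋₊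
    have hm := hreg m (by omega)
    have h1 := integral_abs_pushDensity_sub_iterate_le hβ.2 hA ha N (hmem _ hk)
      (fun j hj1 hj2 => hclose (j + 1) hj2 (by omega)) hh
    have h2 := hlim _ hm N hN1
    have hi := (hm.iterate ha hβ.2 hA N).integrable
    have hi1 : Integrable (fun x => |pushDensity (α n) h (m + N) x -
        (transfer a)^[N] (pushDensity (α n) h m) x|) leb := ((hreg _ hk).integrable.sub hi).abs
    have hi2 : Integrable (fun x => |(transfer a)^[N] (pushDensity (α n) h m) x - w x|) leb :=
      (hi.sub hw).abs
    have h3 : ∫ x, |pushDensity (α n) h (m + N) x - w x| ∂leb ≤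
        ∫ x, (|pushDensity (α n) h (m + N) x -
        (transfer a)^[N] (pushDensity (α n) h m) x| +
        |(transfer a)^[N] (pushDensity (α n) h m) x - w x|) ∂leb :=
      integral_mono ((hreg _ hk).integrable.sub hw).abs (hi1.add hi2) fun x => abs_sub_le _ _ _
    rw [integral_add hi1 hi2] at h3
    exact (h3.trans (add_le_add h1 h2)).trans (rpow_bound hθ hp hC hK₁ hK hn)
  refine ⟨hmap, fun l k hk1 hk2 => ?_, fun f hf l t ht1 ht2 => ?_⟩
  · rw [hsplit] at hk1
    have hτ0 := mul_nonneg hn0.le (hQ.partition_nonneg l.castSucc)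
    have hkn : k ≤ n := by
      have h1 : (k : ℝ) ≤ n := by nlinarith [hQ.partition_le_one l.succ]
      exact_mod_cast h1
    have hmk := hQ.array_mem n k hn hkn
    obtain ⟨w, hw, hw0, hsw, hlim⟩ := hsrb _ hmk
    have hdens := srbDensity_ae_eq hw hw0 hsw
    have ht : (k : ℝ) / n ∈ Ioo (τ l.castSucc) (τ l.succ) :=
      ⟨by rw [lt_div_iff₀ hn0]; linarith, by rw [div_lt_iff₀ hn0]; linarith⟩
    have hnk : (n : ℝ) * (k / n) = k := mul_div_cancel₀ _ hn0.ne'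
    -- Here the frozen value is α_{n,k} itself: passing from γ(k/n) to it costs a third C.
    have h1 := main k _ w hkn (by linarith) hmk hw hlim fun j hj1 hj2 => by
      have h2 := hQ.abs_sub_curve_le_of_near hθ0 hC (by positivity : 0 ≤ θ / 4) hn l ht
        hnk.ge (by linarith) (by linarith) hj1 hj2
      have h3 := hQ.abs_sub_curve_le hn hkn
      have h4 : (n : ℝ) ^ (-θ) ≤ (n : ℝ) ^ ((θ / 4 - 1) * θ) :=
        Real.rpow_le_rpow_of_exponent_le hn1 (by nlinarith)
      have h5 := mul_le_mul_of_nonneg_left h4 hC.le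
      have h6 := abs_sub_le (α n j) (γ (k / n)) (α n k)
      rw [abs_sub_comm] at h3
      linarith
    have hi : Integrable (fun x => pushDensity (α n) h k x - w x) leb :=
      (hreg k hkn).integrable.sub hw
    rw [eLpNorm_congr_ae (g := fun x => pushDensity (α n) h k x - w x)
      (by filter_upwards [hdens] with x hx; rw [hx]), eLpNorm_one_eq_lintegral_enorm,
      ← ofReal_integral_norm_eq_lintegral_enorm hi]
    exact ENNReal.ofReal_le_ofReal h1
  · have hτ0 := hQ.partition_nonneg l.castSucc
    have hpos : 0 ≤ 2 * (n : ℝ) ^ (θ / 4 - 1) := by positivity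
    have ht0 : 0 ≤ t := by linarith
    have ht1' : t ≤ 1 := ht2.le.trans (hQ.partition_le_one _)
    have hnt : n * τ l.castSucc + 2 * (n : ℝ) ^ (θ / 4) < n * t := by
      rw [← hsplit]; exact mul_lt_mul_of_pos_left ht1 hn0
    have hkt : (⌊(n : ℝ) * t⌋₊ : ℝ) ≤ n * t := Nat.floor_le (by positivity)
    have htk := Nat.lt_floor_add_one ((n : ℝ) * t)
    set k := ⌊(n : ℝ) * t⌋₊
    have hkn : k ≤ n := by
      have h1 : (k : ℝ) ≤ n := by nlinarith
      exact_mod_cast h1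
    have hγ := hQ.curve_mem t ⟨ht0, ht1'⟩
    obtain ⟨w, hw, hw0, hsw, hlim⟩ := hsrb _ hγ
    have hτn := mul_nonneg hn0.le hτ0
    have h1 := main k _ w hkn (by linarith) hγ hw hlim fun j hj1 hj2 => by
      have h2 := hQ.abs_sub_curve_le_of_near hθ0 hC (by positivity : 0 ≤ θ / 4) hn l
        ⟨by linarith, ht2⟩ hkt htk (by linarith) hj1 hj2
      have h3 : 0 ≤ C * (n : ℝ) ^ ((θ / 4 - 1) * θ) := by positivity
      linarith
    -- f is measurable only up to Lebesgue-null sets; this suffices because the pushforward is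
    -- absolutely continuous.
    have hfm : AEStronglyMeasurable f (μ.map (evolve (α n) k)) := by
      rw [hmap k hkn]
      exact hf.1.mono_ac (withDensity_absolutelyContinuous _ _)
    rw [← integral_map (measurable_evolve _ k).aemeasurable hfm, hmap k hkn, hsw]
    refine (abs_integral_withDensity_sub_le (hreg k hkn).integrable
      (hreg k hkn).toIsDecr.ae_nonneg hw (ae_of_all _ hw0) hf).trans ?_
    calc _ ≤ _ := mul_le_mul_of_nonneg_left h1 ENNReal.toReal_nonneg
      _ = _ := by ring
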